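/- **Setting.** Let $M=S(TS^2)=\{(p,v)\in\mathbb R^3\times\mathbb R^3:\ |p|=|v|=1,\ p\perp v\}$ be the unit sphere bundle of the round two-sphere, with the action $x(p,v)=(xp,xv)$ of $G=\mathrm{SO}(3)$ (so that $M\cong \mathrm{SO}(3)$), let $\varphi$ be the geodesic flow on $M$, and let $u$ be its generating vector field. For $x\in G$ put $$L_x(\varphi)=\{l\in\mathbb R\setminus\{0\}:\ \exists m\in M,\ \varphi_l(m)=xm\},$$ and let $\Gamma^x_l(\varphi)$ be the set of flow curves $\gamma:\mathbb R\to M$ of $\varphi$ with $\gamma(l)=x\gamma(0)$, modulo time shifts. For such $\gamma$ let $P^x_\gamma$ be the endomorphism of $T_{\gamma(0)}M/\mathbb R u(\gamma(0))$ induced by $T_{\gamma(0)}(\varphi_l\circ x^{-1})$. The flow is called $x$-nondegenerate if $\det(P^x_\gamma-1)\neq 0$ for all $l\ne 0$ and all flow curves $\gamma$ with $\gamma(l)=x\gamma(0)$. Give $G$ its Haar measure of total mass $1$. A cutoff function is a $\chi\in C_c^\infty(M)$, real-valued, with $\int_G\chi(xm)\,dx=1$ for all $m\in M$; put $T_\gamma=\int_{I_\gamma}\chi(\gamma(s))\,ds$,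 where $I_\gamma$ is an interval such that $\gamma|_{I_\gamma}$ is a bijection onto the image of $\gamma$ modulo sets of measure zero. Let $F=M\times\mathbb C$ be the trivial line bundle (with $G$ acting trivially on the fibres) and $\nabla^F=d$ the trivial connection, and let $\rho_x(\gamma):F_{\gamma(0)}\to F_{\gamma(0)}$ be the parallel transport along $\gamma$ from $F_{\gamma(0)}$ to $F_{\gamma(-l)}$ followed by the action of $x$. For $g\in G$ with centraliser $Z$, give $G/Z$ its $G$-invariant measure of total mass $1$, and define $$2\log R^g_{\varphi,\nabla^F}(\sigma)=\int_{G/Z}\ \sum_{l\in L_g(\varphi)}\frac{e^{-|l|\sigma}}{|l|}\sum_{\gamma\in\Gamma_l^{hgh^{-1}}(\varphi)}\operatorname{sgn}\bigl(\det(1-P_\gamma^{hgh^{-1}})\bigr)\operatorname{tr}\bigl(\rho_{hgh^{-1}}(\gamma)\bigr)\,T_\gamma\ d(hZ).$$ **Proposition.** Let $\theta\in\mathbb R$, and let $g\in \mathrm{SO}(3)$ be a rotation by the angle $\theta$, i.e. $g=k\,r(\theta)\,k^{-1}$ for some $k\in \mathrm{SO}(3)$, where $r(\alpha)$ is the rotation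 by $\alpha$ about the third coordinate axis. Suppose that the powers $g^n$, $n\in\mathbb Z$, are dense in the maximal torus $\{k\,r(\alpha)\,k^{-1}:\alpha\in\mathbb R\}$. Then: 1. the flow $\varphi$ is $g$-nondegenerate, and the set $L_g(\varphi)$ is countable; 2. cutoff functions exist, and for every cutoff function $\chi$ and every $\sigma\in\mathbb C$ with $\operatorname{Re}\sigma>0$ the expression defining $\log R^g_{\varphi,\nabla^F}(\sigma)$ converges (the sums absolutely), and $$\log R^g_{\varphi,\nabla^F}(\sigma)=\pi\sum_{n\in\mathbb Z}\left(\frac{e^{-|\theta+2\pi n|\sigma}}{|\theta+2\pi n|}+\frac{e^{-|-\theta+2\pi n|\sigma}}{|-\theta+2\pi n|}\right),$$ where the series on the right converges absolutely; 3. in contrast, the classical Ruelle $\zeta$-function (the case of the identity element $e$) is not defined for this flow: $\varphi$ is not $e$-nondegenerate, and for every nonzero $j\in\mathbb Z$ the set $\Gamma^e_{2\pi j}(\varphi)$ of closed flow curves is uncountable. -/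

import Mathlib

open MeasureTheory

noncomputable section

/-! ## Flows on embedded manifolds and the equivariant Ruelle zeta function

`M` is an embedded submanifold of a normed space `E`, given as a subset; its points form the
subtype `↥M`, on which a group `G` acts and on which `φ : ℝ → M → M` is a flow. -/

/-- The tangent space of `M` at `m`: the span of the velocities at `m` of curves in `M`. -/
def embTangentSpace {E : Type*} [NormedAddCommGroup E] [NormedSpace ℝ E] (M : Set E) (m : M) :
    Submodule ℝ E :=
  Submodule.span ℝ {w : E | ∃ c : ℝ → M, c 0 = m ∧ HasDerivAt (fun t => (c t : E)) w 0}

/-- `χ : M → ℝ` is smooth: locally it is the restriction of a smooth function on `E`. -/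
def IsSmoothOnEmb {E : Type*} [NormedAddCommGroup E] [NormedSpace ℝ E] (M : Set E)
    (χ : M → ℝ) : Prop :=
  ∀ m : M, ∃ f : E → ℝ, ContDiff ℝ ((⊤ : ℕ∞) : WithTop ℕ∞) f ∧
    ∀ᶠ m' : M in nhds m, f (m' : E) = χ m'

/-- `A` is the differential `T_m f : T_m M → T_m M` of a map `f : M → M` with fixed point `m`:
it sends the velocity of a curve through `m` to the velocity of the image curve. -/
def IsDifferentialAtFixed {E : Type*} [NormedAddCommGroup E] [NormedSpace ℝ E] (M : Set E)
    (f : M → M) (m : M) (A : embTangentSpace M m →ₗ[ℝ] embTangentSpace M m) : Prop :=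
  ∀ (c : ℝ → M) (w : embTangentSpace M m), c 0 = m →
    HasDerivAt (fun t => (c t : E)) (w : E) 0 →
    HasDerivAt (fun t => (f (c t) : E)) (A w : E) 0

/-- The generating vector field `u` of the flow. -/
def flowGenerator {E : Type*} [NormedAddCommGroup E] [NormedSpace ℝ E] {M : Set E}
    (φ : ℝ → M → M) (m : M) : E :=
  deriv (fun t => (φ t m : E)) 0

/-- The line `ℝ u(m)` as a subspace of `T_m M`. -/
def flowLine {E : Type*} [NormedAddCommGroup E] [NormedSpace ℝ E] {M : Set E}
    (φ : ℝ → M → M) (m : M) : Submodule ℝ (embTangentSpace M m) :=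
  (Submodule.span ℝ {flowGenerator φ m}).submoduleOf (embTangentSpace M m)

/-- `P` is the linearised `x`-delocalised Poincaré map at a point `m` with `φ_l(m) = x m`: the map
on `T_m M / ℝ u(m)` induced by `T_m (φ_l ∘ x⁻¹)`. -/
def IsPoincareMap {E : Type*} [NormedAddCommGroup E] [NormedSpace ℝ E] {M : Set E}
    {G : Type*} [Group G] [MulAction G M] (φ : ℝ → M → M) (x : G) (l : ℝ) (m : M)
    (P : (embTangentSpace M m ⧸ flowLine φ m) →ₗ[ℝ] (embTangentSpace M m ⧸ flowLine φ m)) :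
    Prop :=
  ∃ A : embTangentSpace M m →ₗ[ℝ] embTangentSpace M m,
    IsDifferentialAtFixed M (fun y => φ l (x⁻¹ • y)) m A ∧
    ∀ w, P ((flowLine φ m).mkQ w) = (flowLine φ m).mkQ (A w)

/-- The flow is `x`-nondegenerate: whenever `l ≠ 0` and `φ_l(m) = x m`, the Poincaré map `P`
satisfies `det (P - 1) ≠ 0`. -/
def IsNondegenerateFlow {E : Type*} [NormedAddCommGroup E] [NormedSpace ℝ E] {M : Set E}
    {G : Type*} [Group G] [MulAction G M] (φ : ℝ → M → M) (x : G) : Prop :=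
  ∀ (l : ℝ) (m : M), l ≠ 0 → φ l m = x • m →
    ∃ P, IsPoincareMap φ x l m P ∧ LinearMap.det (P - 1) ≠ 0

open Classical in
/-- `sgn (det (1 - P))`, where `P` is the linearised `x`-delocalised Poincaré map. -/
def poincareSign {E : Type*} [NormedAddCommGroup E] [NormedSpace ℝ E] {M : Set E}
    {G : Type*} [Group G] [MulAction G M] (φ : ℝ → M → M) (x : G) (l : ℝ) (m : M) : ℝ :=
  if h : ∃ P, IsPoincareMap φ x l m P then Real.sign (LinearMap.det (1 - h.choose)) else 0

/-- The `x`-delocalised length spectrum `L_x(φ)`. -/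
def lengthSpectrum {E : Type*} {M : Set E} {G : Type*} [Group G] [MulAction G M]
    (φ : ℝ → M → M) (x : G) : Set ℝ :=
  {l : ℝ | l ≠ 0 ∧ ∃ m : M, φ l m = x • m}

/-- The set of `(x, l)`-periodic flow curves. -/
def PeriodicFlowCurve {E : Type*} {M : Set E} {G : Type*} [Group G] [MulAction G M]
    (φ : ℝ → M → M) (x : G) (l : ℝ) : Type _ :=
  {γ : ℝ → M // (∀ t, γ t = φ t (γ 0)) ∧ γ l = x • γ 0}

/-- Two periodic flow curves are equivalent if they differ by a time shift, that is, if they lie in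
the same orbit of the action of `ℝ`. -/
def flowCurveSetoid {E : Type*} {M : Set E} {G : Type*} [Group G] [MulAction G M]
    (φ : ℝ → M → M) (x : G) (l : ℝ) : Setoid (PeriodicFlowCurve φ x l) where
  r γ γ' := ∃ s : ℝ, ∀ t, γ'.1 t = γ.1 (t + s)
  iseqv :=
    { refl := fun γ => ⟨0, fun t => by rw [add_zero]⟩
      symm := by
        rintro γ γ' ⟨s, hs⟩
        exact ⟨-s, fun t => by rw [hs, neg_add_cancel_right]⟩
      trans := by
        rintro γ γ' γ'' ⟨s, hs⟩ ⟨s', hs'⟩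
        exact ⟨s' + s, fun t => by rw [hs', hs, add_assoc]⟩ }

/-- The set `Γ_l^x(φ)` of `(x, l)`-periodic flow curves modulo time shift. -/
def PeriodicOrbits {E : Type*} {M : Set E} {G : Type*} [Group G] [MulAction G M]
    (φ : ℝ → M → M) (x : G) (l : ℝ) : Type _ :=
  Quotient (flowCurveSetoid φ x l)

/-- A complex-valued one-form on `M`; it represents the connection `d + ω` on the trivial complex
line bundle `M × ℂ`. The trivial connection `d` is `ω = 0`. -/
def LineConnection {E : Type*} [NormedAddCommGroup E] [NormedSpace ℝ E] (M : Set E) : Type _ :=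
  ∀ m : M, embTangentSpace M m →ₗ[ℝ] ℂ

/-- The trivial connection `d` on `M × ℂ`. -/
def trivialLineConnection {E : Type*} [NormedAddCommGroup E] [NormedSpace ℝ E] (M : Set E) :
    LineConnection M :=
  fun _ => 0

/-- The section `t ↦ (γ t, s t)` along the curve `γ` is parallel for `d + ω`:
`s' + ω(γ') s = 0`. -/
def IsParallelAlong {E : Type*} [NormedAddCommGroup E] [NormedSpace ℝ E] {M : Set E}
    (ω : LineConnection M) (γ : ℝ → M) (s : ℝ → ℂ) : Prop :=
  ∀ t : ℝ, ∃ w : embTangentSpace M (γ t),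
    HasDerivAt (fun r => (γ r : E)) (w : E) t ∧ HasDerivAt s (-(ω (γ t) w * s t)) t

open Classical in
/-- Parallel transport along `γ` from time `a` to time `b`, as a linear map between fibres,
which are all equal to `ℂ`. -/
def parallelTransport {E : Type*} [NormedAddCommGroup E] [NormedSpace ℝ E] {M : Set E}
    (ω : LineConnection M) (γ : ℝ → M) (a b : ℝ) : ℂ →ₗ[ℂ] ℂ :=
  if h : ∃ T : ℂ →ₗ[ℂ] ℂ, ∀ s : ℝ → ℂ, IsParallelAlong ω γ s → T (s a) = s b
  then h.choose else 0

/-- The map `ρ_x(γ) : F_{γ(0)} → F_{γ(0)}` for `F = M × ℂ` with the action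
`x (m, z) = (x m, z)`: parallel transport from `F_{γ(0)}` to `F_{γ(-l)}`, followed by the action
`F_{γ(-l)} → F_{γ(0)}` of `x`, which is the identity map of `ℂ`. -/
def holonomyMap {E : Type*} [NormedAddCommGroup E] [NormedSpace ℝ E] {M : Set E}
    (ω : LineConnection M) (γ : ℝ → M) (l : ℝ) : ℂ →ₗ[ℂ] ℂ :=
  LinearMap.id ∘ₗ parallelTransport ω γ 0 (-l)

/-- `I` is an interval such that `γ|_I` is a bijection onto the image of `γ`, modulo sets of
measure zero. -/
def IsFundamentalInterval {X : Type*} (γ : ℝ → X) (I : Set ℝ) : Prop :=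
  I.OrdConnected ∧ (∃ N : Set ℝ, volume N = 0 ∧ Set.InjOn γ (I \ N)) ∧
    volume {t : ℝ | γ t ∉ γ '' I} = 0

/-- The `χ`-primitive period `T_γ = ∫_{I_γ} χ(γ(s)) ds`, for a choice of an interval `I_γ`. -/
def primitivePeriod {X : Type*} (χ : X → ℝ) (γ : ℝ → X) : ℝ :=
  ∫ s in Classical.epsilon (IsFundamentalInterval γ), χ (γ s)

/-- `χ` is a cutoff function: smooth, compactly supported, and `∫_G χ(x m) dx = 1` for all `m`. -/
structure IsCutoffFunction {E : Type*} [NormedAddCommGroup E] [NormedSpace ℝ E] {M : Set E}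
    {G : Type*} [Group G] [MulAction G M] [MeasurableSpace G] (μ : Measure G) (χ : M → ℝ) :
    Prop where
  smooth : IsSmoothOnEmb M χ
  compact_support : HasCompactSupport χ
  integrable_orbit : ∀ m : M, Integrable (fun x : G => χ (x • m)) μ
  integral_orbit : ∀ m : M, ∫ x : G, χ (x • m) ∂μ = 1

/-- The conjugate `h g h⁻¹` as a function of `h Z`, with `Z` the centraliser of `g`. -/
def conjOnQuotient {G : Type*} [Group G] (g : G) (q : G ⧸ Subgroup.centralizer {g}) : G :=
  Quotient.liftOn' q (fun h => h * g * h⁻¹) (by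
    intro a b hab
    have h1 : a⁻¹ * b ∈ Subgroup.centralizer {g} := QuotientGroup.leftRel_apply.mp hab
    have h2 : g * (a⁻¹ * b) = a⁻¹ * b * g := Subgroup.mem_centralizer_iff.mp h1 g rfl
    have h3 : b * g = a * g * a⁻¹ * b := by
      calc b * g = a * (a⁻¹ * b * g) := by group
        _ = a * g * a⁻¹ * b := by rw [← h2]; group
    change a * g * a⁻¹ = b * g * b⁻¹
    rw [h3]; group)

/-- The factor `sgn(det(1 - P_γ^x)) tr(ρ_x(γ)) T_γ` attached to a class `γ` in `Γ_l^x(φ)`. -/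
def orbitWeight {E : Type*} [NormedAddCommGroup E] [NormedSpace ℝ E] {M : Set E}
    {G : Type*} [Group G] [MulAction G M] (φ : ℝ → M → M) (ω : LineConnection M) (χ : M → ℝ)
    (x : G) (l : ℝ) (γ : PeriodicOrbits φ x l) : ℂ :=
  let c : ℝ → M := (Quotient.out γ).1
  (poincareSign φ x l (c 0) : ℂ) * LinearMap.trace ℂ ℂ (holonomyMap ω c l) *
    (primitivePeriod χ c : ℂ)

/-- The term at `l` in the sum over the length spectrum:
`e^{-|l|σ} / |l| * ∑_{γ ∈ Γ_l^x(φ)} sgn(det(1 - P_γ^x)) tr(ρ_x(γ)) T_γ`. -/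
def lengthTerm {E : Type*} [NormedAddCommGroup E] [NormedSpace ℝ E] {M : Set E}
    {G : Type*} [Group G] [MulAction G M] (φ : ℝ → M → M) (ω : LineConnection M) (χ : M → ℝ)
    (σ : ℂ) (x : G) (l : ℝ) : ℂ :=
  Complex.exp (-((|l| : ℝ) : ℂ) * σ) / ((|l| : ℝ) : ℂ) *
    ∑' γ : PeriodicOrbits φ x l, orbitWeight φ ω χ x l γ

/-- The integrand over `G/Z` in the definition of the equivariant Ruelle zeta function. -/
def ruelleIntegrand {E : Type*} [NormedAddCommGroup E] [NormedSpace ℝ E] {M : Set E}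
    {G : Type*} [Group G] [MulAction G M] (φ : ℝ → M → M) (ω : LineConnection M) (χ : M → ℝ)
    (g : G) (σ : ℂ) (q : G ⧸ Subgroup.centralizer {g}) : ℂ :=
  ∑' l : lengthSpectrum φ g, lengthTerm φ ω χ σ (conjOnQuotient g q) l

/-- The expression defining the equivariant Ruelle zeta function at `g` converges at `σ`: the sums
converge absolutely and the integral over `G/Z` exists. -/
structure RuelleConvergesAt {E : Type*} [NormedAddCommGroup E] [NormedSpace ℝ E] {M : Set E}
    {G : Type*} [Group G] [MulAction G M] [MeasurableSpace G] (φ : ℝ → M → M)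
    (ω : LineConnection M) (χ : M → ℝ) (g : G) (ν : Measure (G ⧸ Subgroup.centralizer {g}))
    (σ : ℂ) : Prop where
  summable_orbits : ∀ (q : G ⧸ Subgroup.centralizer {g}) (l : lengthSpectrum φ g),
    Summable (orbitWeight φ ω χ (conjOnQuotient g q) (l : ℝ))
  summable_lengths : ∀ q : G ⧸ Subgroup.centralizer {g},
    Summable fun l : lengthSpectrum φ g => lengthTerm φ ω χ σ (conjOnQuotient g q) l
  integrable : Integrable (ruelleIntegrand φ ω χ g σ) ν

/-- `log R^g_{φ,∇}(σ)`: half of the integral over `G/Z`, where `∇ = d + ω` on `M × ℂ` and `ν` is the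
given invariant measure on `G/Z`. -/
def logRuelle {E : Type*} [NormedAddCommGroup E] [NormedSpace ℝ E] {M : Set E}
    {G : Type*} [Group G] [MulAction G M] [MeasurableSpace G] (φ : ℝ → M → M)
    (ω : LineConnection M) (χ : M → ℝ) (g : G) (ν : Measure (G ⧸ Subgroup.centralizer {g}))
    (σ : ℂ) : ℂ :=
  (1 / 2 : ℂ) * ∫ q, ruelleIntegrand φ ω χ g σ q ∂ν

/-! ## The unit sphere bundle of the two-sphere -/

/-- The group `SO(3)`. -/
abbrev SO3 : Type := Matrix.specialOrthogonalGroup (Fin 3) ℝ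

/-- The rotation `diag(r(α), 1)` about the third axis by the angle `α`. -/
def rotZ (α : ℝ) : SO3 :=
  ⟨!![Real.cos α, -Real.sin α, 0; Real.sin α, Real.cos α, 0; 0, 0, 1], by
    rw [Matrix.mem_specialOrthogonalGroup_iff, Matrix.mem_orthogonalGroup_iff]
    constructor
    · ext i j
      have h := Real.sin_sq_add_cos_sq α
      fin_cases i <;> fin_cases j <;>
        simp [Matrix.mul_apply, Fin.sum_univ_three] <;> nlinarith
    · have h := Real.sin_sq_add_cos_sq α
      simp [Matrix.det_fin_three]
      nlinarith⟩

/-- `S(TS²)`: the pairs `(p, v)` of a point `p` of the unit sphere in `ℝ³` and a unit vector `v`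
tangent to the sphere at `p`. -/
def sphereBundle : Set (EuclideanSpace ℝ (Fin 3) × EuclideanSpace ℝ (Fin 3)) :=
  {m | ‖m.1‖ = 1 ∧ ‖m.2‖ = 1 ∧ inner ℝ m.1 m.2 = 0}

theorem SO3.inner_apply (A : SO3) (v w : EuclideanSpace ℝ (Fin 3)) :
    inner ℝ (Matrix.toEuclideanLin A.1 v) (Matrix.toEuclideanLin A.1 w) = inner ℝ v w := by
  have hA : A.1.transpose * A.1 = 1 := by
    have h := (Matrix.mem_specialOrthogonalGroup_iff.mp A.2).1
    exact (Matrix.mem_orthogonalGroup_iff' (Fin 3) ℝ).mp h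
  rw [EuclideanSpace.inner_eq_star_dotProduct, EuclideanSpace.inner_eq_star_dotProduct]
  simp only [Matrix.ofLp_toLpLin, Matrix.toLin'_apply, star_trivial]
  rw [Matrix.dotProduct_mulVec, Matrix.vecMul_mulVec, hA, Matrix.vecMul_one]

theorem SO3.norm_apply (A : SO3) (v : EuclideanSpace ℝ (Fin 3)) :
    ‖Matrix.toEuclideanLin A.1 v‖ = ‖v‖ := by
  rw [norm_eq_sqrt_real_inner, norm_eq_sqrt_real_inner v, SO3.inner_apply]

/-- The natural action `A (p, v) = (A p, A v)` of `SO(3)` on `S(TS²)`. -/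
instance sphereBundleAction : MulAction SO3 sphereBundle where
  smul A m := ⟨(Matrix.toEuclideanLin A.1 m.1.1, Matrix.toEuclideanLin A.1 m.1.2), by
    obtain ⟨h1, h2, h3⟩ := m.2
    exact ⟨by rw [SO3.norm_apply, h1], by rw [SO3.norm_apply, h2],
      by rw [SO3.inner_apply, h3]⟩⟩
  one_smul m := by
    apply Subtype.ext
    have h : ∀ v : EuclideanSpace ℝ (Fin 3),
        Matrix.toEuclideanLin (1 : Matrix (Fin 3) (Fin 3) ℝ) v = v := by
      intro v
      apply PiLp.ext
      simp
    exact Prod.ext (h _) (h _)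
  mul_smul A B m := by
    apply Subtype.ext
    apply Prod.ext <;>
    · refine (?_ : Matrix.toEuclideanLin (A.1 * B.1) _ = Matrix.toEuclideanLin A.1
        (Matrix.toEuclideanLin B.1 _))
      apply PiLp.ext
      simp [Matrix.toLpLin_apply, Matrix.mulVec_mulVec]

/-- `φ` is the geodesic flow on `S(TS²)`: `φ_t(p, v) = (c(t), c'(t))` for the geodesic `c` on the
round sphere with `c(0) = p` and `c'(0) = v`. A curve `c` on the sphere is a geodesic if its
covariant acceleration, which is the tangential part of `c''`, vanishes. -/
structure IsSphereGeodesicFlow (φ : ℝ → sphereBundle → sphereBundle) : Prop where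
  map_zero : ∀ m, φ 0 m = m
  velocity : ∀ m t, HasDerivAt (fun s => (φ s m).1.1) (φ t m).1.2 t
  acceleration : ∀ m t, ∃ a : EuclideanSpace ℝ (Fin 3),
    HasDerivAt (fun s => (φ s m).1.2) a t ∧
    ∀ w : EuclideanSpace ℝ (Fin 3), inner ℝ (φ t m).1.1 w = 0 → inner ℝ a w = 0

/-- The geodesic flow on `S(TS²)` exists. -/
theorem exists_isSphereGeodesicFlow :
    ∃ φ : ℝ → sphereBundle → sphereBundle, IsSphereGeodesicFlow φ := by
  have key : ∀ (t : ℝ) (m : sphereBundle),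
      (Real.cos t • m.1.1 + Real.sin t • m.1.2, -Real.sin t • m.1.1 + Real.cos t • m.1.2)
        ∈ sphereBundle := by
    rintro t ⟨⟨p, v⟩, h1, h2, h3⟩
    simp only at h1 h2 h3
    have h4 : inner ℝ v p = 0 := by rw [real_inner_comm]; exact h3
    have hp : inner ℝ p p = 1 := by rw [real_inner_self_eq_norm_sq, h1, one_pow]
    have hv : inner ℝ v v = 1 := by rw [real_inner_self_eq_norm_sq, h2, one_pow]
    have hs := Real.sin_sq_add_cos_sq t
    refine ⟨?_, ?_, ?_⟩
    · rw [norm_eq_sqrt_real_inner, Real.sqrt_eq_one]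
      simp only [inner_add_left, inner_add_right, real_inner_smul_left, real_inner_smul_right,
        h3, h4, hp, hv]
      nlinarith
    · rw [norm_eq_sqrt_real_inner, Real.sqrt_eq_one]
      simp only [inner_add_left, inner_add_right, real_inner_smul_left, real_inner_smul_right,
        h3, h4, hp, hv]
      nlinarith
    · simp only [inner_add_left, inner_add_right, real_inner_smul_left, real_inner_smul_right,
        h3, h4, hp, hv]
      ring
  refine ⟨fun t m => ⟨_, key t m⟩, ?_, ?_, ?_⟩
  · intro m
    apply Subtype.ext
    apply Prod.ext <;> simp
  · intro m t
    exact ((Real.hasDerivAt_cos t).smul_const m.1.1).add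
      ((Real.hasDerivAt_sin t).smul_const m.1.2)
  · intro m t
    refine ⟨_, ((Real.hasDerivAt_sin t).neg.smul_const m.1.1).add
      ((Real.hasDerivAt_cos t).smul_const m.1.2), ?_⟩
    intro w hw
    simp only [inner_add_left, real_inner_smul_left] at hw ⊢
    linarith

end

noncomputable section

/-! ## The group `SO(3)` -/

namespace SO3

/-! The map `A ↦ A • baseFrame` identifies `S(TS²)` with `SO(3)`. Under it the action of `SO(3)` is
left multiplication, and the geodesic flow is right multiplication by `rotZ t`. Hence `φ_l(m) = x m`
at the frame `A` means `x = A * rotZ l * A⁻¹` (`eq_smul_iff`), and the dynamics becomes conjugacy in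
`SO(3)`.

The trace determines the angle up to sign modulo `2π`, so `L_g(φ) = ±θ + 2πℤ`. Density of the powers
of `g` enters only through `sin θ ≠ 0`. Then the two families are disjoint and avoid `0`, and the
centraliser of `rotZ l` is the torus of the `rotZ s`, so each length carries exactly one orbit.

Pairing tangent vectors with the normal `p × v` identifies `T_m M / ℝ u` with `ℝ²`, and the Poincaré
map becomes a plane rotation with `det (1 - P) = 2 - 2 cos l > 0`. Thus every sign is `1`; the
holonomy is `1` as well, and the weight of an orbit is just the integral of `χ` over a circle of
length `2π`. Averaging this integral over `G` gives `2π`, by the defining property of a cutoff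
function and Fubini, and invariance transfers the value to `G/Z`. The factor `1/2` turns `2π` into
`π`.

For the identity element every point returns at time `2πj`; at time `2π` the Poincaré map is the
identity, and angular momentum separates uncountably many orbits. -/

theorem transpose_mul_self (A : SO3) : A.1.transpose * A.1 = 1 :=
  (Matrix.mem_orthogonalGroup_iff' (Fin 3) ℝ).mp (Matrix.mem_specialOrthogonalGroup_iff.mp A.2).1

theorem det_eq_one (A : SO3) : A.1.det = 1 :=
  (Matrix.mem_specialOrthogonalGroup_iff.mp A.2).2

theorem coe_inv (A : SO3) : (A⁻¹).1 = A.1.transpose := rfl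

theorem coe_mul (A B : SO3) : (A * B).1 = A.1 * B.1 := rfl

theorem coe_one : (1 : SO3).1 = 1 := rfl

instance : IsTopologicalGroup SO3 where
  continuous_inv := by
    refine Continuous.subtype_mk (f := fun A : SO3 => A.1.transpose) ?_ _
    exact continuous_subtype_val.matrix_transpose

/-- Makes continuous functions on products with `SO3` measurable for the product σ-algebra, as the
applications of Fubini require. -/
instance : SecondCountableTopology SO3 := by
  have : SecondCountableTopology (Matrix (Fin 3) (Fin 3) ℝ) :=
    inferInstanceAs (SecondCountableTopology (Fin 3 → Fin 3 → ℝ))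
  exact TopologicalSpace.Subtype.secondCountableTopology _

theorem trace_conj (A B : SO3) : (A * B * A⁻¹).1.trace = B.1.trace := by
  rw [coe_mul, coe_mul, coe_inv, Matrix.trace_mul_comm, ← mul_assoc, transpose_mul_self, one_mul]

/-- The rotation by `π` about the first axis. -/
def flip : SO3 :=
  ⟨!![1, 0, 0; 0, -1, 0; 0, 0, -1], by
    rw [Matrix.mem_specialOrthogonalGroup_iff, Matrix.mem_orthogonalGroup_iff]
    constructor
    · ext i j
      fin_cases i <;> fin_cases j <;> simp [Matrix.mul_apply, Fin.sum_univ_three]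
    · simp [Matrix.det_fin_three]⟩

end SO3

theorem rotZ_add (a b : ℝ) : rotZ (a + b) = rotZ a * rotZ b := by
  apply Subtype.ext
  rw [SO3.coe_mul]
  ext i j
  fin_cases i <;> fin_cases j <;>
    simp [rotZ, Matrix.mul_apply, Fin.sum_univ_three, Real.cos_add, Real.sin_add] <;> ring

theorem rotZ_zero : rotZ 0 = 1 := by
  apply Subtype.ext
  rw [SO3.coe_one]
  ext i j
  fin_cases i <;> fin_cases j <;> simp [rotZ]

theorem rotZ_neg (a : ℝ) : rotZ (-a) = (rotZ a)⁻¹ := by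
  rw [eq_inv_iff_mul_eq_one, ← rotZ_add, neg_add_cancel, rotZ_zero]

theorem rotZ_congr {a b : ℝ} (hc : Real.cos a = Real.cos b) (hs : Real.sin a = Real.sin b) :
    rotZ a = rotZ b := by
  apply Subtype.ext
  simp only [rotZ, hc, hs]

theorem rotZ_add_int_mul_two_pi (a : ℝ) (n : ℤ) : rotZ (a + n * (2 * Real.pi)) = rotZ a :=
  rotZ_congr (Real.cos_add_int_mul_two_pi a n) (Real.sin_add_int_mul_two_pi a n)

theorem rotZ_eq_one_iff (a : ℝ) : rotZ a = 1 ↔ ∃ n : ℤ, (n : ℝ) * (2 * Real.pi) = a := by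
  rw [← Real.cos_eq_one_iff]
  constructor
  · intro h
    have h1 := congrArg (fun A : SO3 => A.1 0 0) h
    simpa [rotZ] using h1
  · intro h
    rw [← rotZ_zero]
    refine rotZ_congr (by simp [h]) ?_
    have := Real.sin_sq_add_cos_sq a
    rw [h] at this
    rw [Real.sin_zero]
    nlinarith

theorem rotZ_trace (a : ℝ) : (rotZ a).1.trace = 2 * Real.cos a + 1 := by
  simp [rotZ, Matrix.trace, Fin.sum_univ_three]
  ring

/-- A half-turn about the first axis reverses the third axis, hence the sense of rotation about it.
This is why both `θ` and `-θ` contribute. -/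
theorem flip_mul_rotZ_neg (a : ℝ) : SO3.flip * rotZ (-a) * SO3.flip⁻¹ = rotZ a := by
  rw [mul_inv_eq_iff_eq_mul]
  apply Subtype.ext
  rw [SO3.coe_mul, SO3.coe_mul]
  ext i j
  fin_cases i <;> fin_cases j <;>
    simp [rotZ, SO3.flip, Matrix.mul_apply, Fin.sum_univ_three]

/-- The centraliser of a rotation about the third axis by an angle outside `ℤπ` consists of
rotations about the third axis. -/
theorem exists_rotZ_of_commute {K : SO3} {a : ℝ} (ha : Real.sin a ≠ 0)
    (h : K * rotZ a = rotZ a * K) : ∃ s, K = rotZ s := by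
  have h1 : K.1 * (rotZ a).1 = (rotZ a).1 * K.1 := congrArg Subtype.val h
  have e := fun i j => congrFun (congrFun h1 i) j
  simp only [rotZ, Matrix.mul_apply, Fin.sum_univ_three] at e
  have o := fun i j => congrFun (congrFun (SO3.transpose_mul_self K) i) j
  simp only [Matrix.mul_apply, Fin.sum_univ_three, Matrix.transpose_apply] at o
  have d := SO3.det_eq_one K
  rw [Matrix.det_fin_three] at d
  have hsc := Real.sin_sq_add_cos_sq a
  have hc : Real.cos a - 1 ≠ 0 := by
    intro h0
    apply ha
    have : Real.cos a = 1 := by linarith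
    rw [this] at hsc
    nlinarith
  have e00 := e 0 0
  have e01 := e 0 1
  have e02 := e 0 2
  have e12 := e 1 2
  have e20 := e 2 0
  have e21 := e 2 1
  simp at e00 e01 e02 e12 e20 e21
  have o00 := o 0 0
  simp at o00
  have h10 : K.1 0 1 = -K.1 1 0 := by
    have : (K.1 0 1 + K.1 1 0) * Real.sin a = 0 := by linarith
    rcases mul_eq_zero.mp this with h | h
    · linarith
    · exact absurd h ha
  have h11 : K.1 1 1 = K.1 0 0 := by
    have : (K.1 1 1 - K.1 0 0) * Real.sin a = 0 := by linarith
    rcases mul_eq_zero.mp this with h | h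
    · linarith
    · exact absurd h ha
  -- This is the determinant of the upper left block of `rotZ a - 1`; since it is nonzero, that
  -- block annihilates no nonzero vector, which kills the mixed entries of `K`.
  have hne : (Real.cos a - 1) ^ 2 + Real.sin a ^ 2 ≠ 0 := by positivity
  have h02 : K.1 0 2 = 0 := by
    have : K.1 0 2 * ((Real.cos a - 1) ^ 2 + Real.sin a ^ 2) = 0 := by
      linear_combination (1 - Real.cos a) * e02 - Real.sin a * e12
    exact (mul_eq_zero.mp this).resolve_right hne
  have h12 : K.1 1 2 = 0 := by
    have : K.1 1 2 * ((Real.cos a - 1) ^ 2 + Real.sin a ^ 2) = 0 := by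
      linear_combination (1 - Real.cos a) * e12 + Real.sin a * e02
    exact (mul_eq_zero.mp this).resolve_right hne
  have h20 : K.1 2 0 = 0 := by
    have : K.1 2 0 * ((Real.cos a - 1) ^ 2 + Real.sin a ^ 2) = 0 := by
      linear_combination (Real.cos a - 1) * e20 - Real.sin a * e21
    exact (mul_eq_zero.mp this).resolve_right hne
  have h21 : K.1 2 1 = 0 := by
    have : K.1 2 1 * ((Real.cos a - 1) ^ 2 + Real.sin a ^ 2) = 0 := by
      linear_combination (Real.cos a - 1) * e21 + Real.sin a * e20
    exact (mul_eq_zero.mp this).resolve_right hne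
  have hunit : K.1 0 0 ^ 2 + K.1 1 0 ^ 2 = 1 := by
    rw [h20] at o00
    linarith
  have h22 : K.1 2 2 = 1 := by
    rw [h02, h12, h20, h21, h10, h11] at d
    linear_combination d - K.1 2 2 * hunit
  -- The first column of the remaining planar block, read as a unit complex number, has argument
  -- `s`.
  obtain ⟨s, hs⟩ : ∃ s : ℝ, Complex.exp (s * Complex.I) = ⟨K.1 0 0, K.1 1 0⟩ := by
    rw [← Complex.norm_eq_one_iff, Complex.norm_def, Complex.normSq_mk, Real.sqrt_eq_one]
    linarith
  have hre : Real.cos s = K.1 0 0 := by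
    rw [← Complex.exp_ofReal_mul_I_re, hs]
  have him : Real.sin s = K.1 1 0 := by
    rw [← Complex.exp_ofReal_mul_I_im, hs]
  refine ⟨s, Subtype.ext ?_⟩
  ext i j
  fin_cases i <;> fin_cases j <;> simp [rotZ, hre, him, h10, h11, h02, h12, h20, h21, h22]

/-- Conjugate rotations about the third axis have the same angle up to sign, modulo `2π`. -/
theorem angle_of_conj {A B : SO3} {a b : ℝ} (h : A * rotZ a * A⁻¹ = B * rotZ b * B⁻¹) :
    ∃ n : ℤ, a = b + 2 * Real.pi * n ∨ a = -b + 2 * Real.pi * n := by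
  have h1 := congrArg (fun X : SO3 => X.1.trace) h
  simp only [SO3.trace_conj, rotZ_trace] at h1
  have h2 : Real.cos b = Real.cos a := by linarith
  obtain ⟨n, hn | hn⟩ := Real.cos_eq_cos_iff.mp h2
  · exact ⟨n, Or.inl (by rw [hn]; ring)⟩
  · exact ⟨n, Or.inr (by rw [hn]; ring)⟩

/-! ## The unit sphere bundle as a principal homogeneous space -/

/-- The pair `(e₁, e₂)` in `S(TS²)`. -/
def baseFrame : sphereBundle :=
  ⟨(EuclideanSpace.single 0 1, EuclideanSpace.single 1 1), by
    refine ⟨by simp, by simp, ?_⟩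
    simp [PiLp.inner_apply]⟩

theorem smul_fst (A : SO3) (m : sphereBundle) :
    (A • m).1.1 = Matrix.toEuclideanLin A.1 m.1.1 := rfl

theorem smul_snd (A : SO3) (m : sphereBundle) :
    (A • m).1.2 = Matrix.toEuclideanLin A.1 m.1.2 := rfl

theorem smul_baseFrame_fst (A : SO3) (i : Fin 3) : (A • baseFrame).1.1 i = A.1 i 0 := by
  simp [smul_fst, baseFrame]

theorem smul_baseFrame_snd (A : SO3) (i : Fin 3) : (A • baseFrame).1.2 i = A.1 i 1 := by
  simp [smul_snd, baseFrame]

/-- The cross product `p × v` completes `(p, v)` to an oriented orthonormal frame and serves as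
third column. -/
theorem exists_smul_baseFrame (m : sphereBundle) : ∃ A : SO3, A • baseFrame = m := by
  obtain ⟨⟨p, v⟩, hp, hv, hpv⟩ := m
  simp only at hp hv hpv
  have hp' : p 0 ^ 2 + p 1 ^ 2 + p 2 ^ 2 = 1 := by
    have := EuclideanSpace.real_norm_sq_eq p
    rw [hp, Fin.sum_univ_three] at this
    linarith
  have hv' : v 0 ^ 2 + v 1 ^ 2 + v 2 ^ 2 = 1 := by
    have := EuclideanSpace.real_norm_sq_eq v
    rw [hv, Fin.sum_univ_three] at this
    linarith
  have hpv' : p 0 * v 0 + p 1 * v 1 + p 2 * v 2 = 0 := by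
    simp only [PiLp.inner_apply, Fin.sum_univ_three, RCLike.inner_apply, conj_trivial] at hpv
    linarith
  refine ⟨⟨!![p 0, v 0, p 1 * v 2 - p 2 * v 1; p 1, v 1, p 2 * v 0 - p 0 * v 2;
      p 2, v 2, p 0 * v 1 - p 1 * v 0], ?_⟩, ?_⟩
  · rw [Matrix.mem_specialOrthogonalGroup_iff, Matrix.mem_orthogonalGroup_iff']
    -- Lagrange's identity `|p × v|² = |p|²|v|² - ⟨p, v⟩²`.
    have hd : (p 1 * v 2 - p 2 * v 1) ^ 2 + (p 2 * v 0 - p 0 * v 2) ^ 2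
        + (p 0 * v 1 - p 1 * v 0) ^ 2 = 1 := by
      linear_combination (v 0 ^ 2 + v 1 ^ 2 + v 2 ^ 2) * hp' + hv'
        - (p 0 * v 0 + p 1 * v 1 + p 2 * v 2) * hpv'
    constructor
    · ext i j
      fin_cases i <;> fin_cases j <;>
        simp [Matrix.mul_apply, Fin.sum_univ_three] <;>
        first
        | linear_combination hp'
        | linear_combination hv'
        | linear_combination hpv'
        | linear_combination hd
        | ring
    · simp [Matrix.det_fin_three]
      linear_combination hd
  · apply Subtype.ext
    refine Prod.ext ?_ ?_
    · ext i
      rw [smul_baseFrame_fst]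
      fin_cases i <;> rfl
    · ext i
      rw [smul_baseFrame_snd]
      fin_cases i <;> rfl

/-- A rotation fixing `e₁` and `e₂` fixes `e₃`, by orthogonality of the columns and determinant one.
-/
theorem smul_baseFrame_injective {A B : SO3} (h : A • baseFrame = B • baseFrame) : A = B := by
  rw [← inv_smul_eq_iff, smul_smul] at h
  rw [← inv_mul_eq_one]
  suffices key : ∀ C : SO3, C • baseFrame = baseFrame → C = 1 by
    have := key _ h
    rw [← inv_eq_one, mul_inv_rev, inv_inv] at this
    exact this
  intro C hC
  have h0 : ∀ i, C.1 i 0 = baseFrame.1.1 i := fun i => by rw [← smul_baseFrame_fst, hC]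
  have h1 : ∀ i, C.1 i 1 = baseFrame.1.2 i := fun i => by rw [← smul_baseFrame_snd, hC]
  have o := fun i j => congrFun (congrFun (SO3.transpose_mul_self C) i) j
  simp only [Matrix.mul_apply, Fin.sum_univ_three, Matrix.transpose_apply] at o
  have d := SO3.det_eq_one C
  rw [Matrix.det_fin_three] at d
  have a0 := h0 0
  have a1 := h0 1
  have a2 := h0 2
  have b0 := h1 0
  have b1 := h1 1
  have b2 := h1 2
  have o02 := o 0 2
  have o12 := o 1 2
  simp [baseFrame] at a0 a1 a2 b0 b1 b2
  simp [a0, a1, a2, b0, b1, b2] at o02 o12 d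
  apply Subtype.ext
  rw [SO3.coe_one]
  ext i j
  fin_cases i <;> fin_cases j <;> simp [a0, a1, a2, b0, b1, b2, o02, o12, d]

instance : ContinuousSMul SO3 sphereBundle := by
  have key : ∀ f : SO3 × sphereBundle → EuclideanSpace ℝ (Fin 3), Continuous f →
      Continuous fun q => Matrix.toEuclideanLin q.1.1 (f q) := by
    intro f hf
    have h1 : Continuous fun q : SO3 × sphereBundle => q.1.1.mulVec (f q).ofLp :=
      Continuous.matrix_mulVec (continuous_subtype_val.comp continuous_fst)
        ((PiLp.continuous_ofLp 2 _).comp hf)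
    exact (PiLp.continuous_toLp 2 _).comp h1
  refine ⟨Continuous.subtype_mk (Continuous.prodMk (key _ ?_) (key _ ?_)) _⟩
  · exact continuous_fst.comp (continuous_subtype_val.comp continuous_snd)
  · exact continuous_snd.comp (continuous_subtype_val.comp continuous_snd)

instance : CompactSpace sphereBundle := by
  rw [← isCompact_iff_compactSpace]
  apply Metric.isCompact_of_isClosed_isBounded
  · have h : sphereBundle = {m | ‖m.1‖ = 1} ∩ ({m | ‖m.2‖ = 1} ∩ {m | inner ℝ m.1 m.2 = 0}) := rfl
    rw [h]
    refine IsClosed.inter ?_ (IsClosed.inter ?_ ?_)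
    · exact isClosed_eq (by fun_prop) continuous_const
    · exact isClosed_eq (by fun_prop) continuous_const
    · exact isClosed_eq (continuous_fst.inner continuous_snd) continuous_const
  · rw [isBounded_iff_forall_norm_le]
    exact ⟨1, fun m hm => max_le hm.1.le hm.2.1.le⟩

/-! ## The geodesic flow -/

variable {φ : ℝ → sphereBundle → sphereBundle}

/-- Differentiating `⟨p, v⟩ = 0` gives `⟨p, a⟩ = -1`, so `a + p` is tangent. It is therefore
orthogonal to `a` as well as to `p`, hence to itself, and `a = -p`. -/
theorem IsSphereGeodesicFlow.hasDerivAt_snd (hφ : IsSphereGeodesicFlow φ) (m : sphereBundle)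
    (t : ℝ) : HasDerivAt (fun s => (φ s m).1.2) (-(φ t m).1.1) t := by
  obtain ⟨a, ha, hw⟩ := hφ.acceleration m t
  have h0 : (fun s => inner ℝ (φ s m).1.1 (φ s m).1.2) = fun _ => (0 : ℝ) :=
    funext fun s => (φ s m).2.2.2
  have h1 := (hφ.velocity m t).inner ℝ ha
  rw [h0] at h1
  have h2 := h1.unique (hasDerivAt_const t 0)
  have hp : inner ℝ (φ t m).1.1 (φ t m).1.1 = (1 : ℝ) := by
    rw [real_inner_self_eq_norm_sq, (φ t m).2.1, one_pow]
  have hv : inner ℝ (φ t m).1.2 (φ t m).1.2 = (1 : ℝ) := by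
    rw [real_inner_self_eq_norm_sq, (φ t m).2.2.1, one_pow]
  rw [hv] at h2
  have h3 : inner ℝ (φ t m).1.1 (a + (φ t m).1.1) = (0 : ℝ) := by
    rw [inner_add_right, hp]
    linarith
  have h4 := hw _ h3
  have h5 : a + (φ t m).1.1 = 0 := by
    rw [← inner_self_eq_zero (𝕜 := ℝ), inner_add_left, h4, h3, add_zero]
  rw [eq_neg_of_add_eq_zero_left h5] at ha
  exact ha

/-- Rotating the pair `(p(t), v(t))` back by the angle `t` gives a curve with zero derivative, so
the flow is determined by its initial value. -/
theorem IsSphereGeodesicFlow.coe_apply (hφ : IsSphereGeodesicFlow φ) (t : ℝ) (m : sphereBundle) :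
    (φ t m).1 = (Real.cos t • m.1.1 + Real.sin t • m.1.2,
      -Real.sin t • m.1.1 + Real.cos t • m.1.2) := by
  have hx := hφ.velocity m
  have hy := hφ.hasDerivAt_snd m
  have h1 : ∀ t, HasDerivAt (fun s => Real.cos s • (φ s m).1.1 - Real.sin s • (φ s m).1.2) 0 t := by
    intro t
    refine (((Real.hasDerivAt_cos t).smul (hx t)).sub
      ((Real.hasDerivAt_sin t).smul (hy t))).congr_deriv ?_
    module
  have h2 : ∀ t, HasDerivAt (fun s => Real.sin s • (φ s m).1.1 + Real.cos s • (φ s m).1.2) 0 t := by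
    intro t
    refine (((Real.hasDerivAt_sin t).smul (hx t)).add
      ((Real.hasDerivAt_cos t).smul (hy t))).congr_deriv ?_
    module
  have e1 := is_const_of_deriv_eq_zero (fun t => (h1 t).differentiableAt)
    (fun t => (h1 t).deriv) t 0
  have e2 := is_const_of_deriv_eq_zero (fun t => (h2 t).differentiableAt)
    (fun t => (h2 t).deriv) t 0
  simp only [hφ.map_zero, Real.cos_zero, Real.sin_zero, one_smul, zero_smul, sub_zero,
    zero_add] at e1 e2
  have hs := Real.cos_sq_add_sin_sq t
  rw [← e1, ← e2]
  refine Prod.ext ?_ ?_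
  · ext i
    simp only [PiLp.add_apply, PiLp.sub_apply, PiLp.smul_apply, smul_eq_mul]
    linear_combination (-(φ t m).1.1 i) * hs
  · ext i
    simp only [PiLp.add_apply, PiLp.sub_apply, PiLp.smul_apply, smul_eq_mul]
    linear_combination (-(φ t m).1.2 i) * hs

/-- The first two columns of `K * rotZ t` are exactly the combinations of `p` and `v` that solve the
geodesic equation. -/
theorem IsSphereGeodesicFlow.smul_baseFrame (hφ : IsSphereGeodesicFlow φ) (t : ℝ) (K : SO3) :
    φ t (K • baseFrame) = (K * rotZ t) • baseFrame := by
  apply Subtype.ext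
  rw [hφ.coe_apply]
  refine Prod.ext ?_ ?_
  · ext i
    rw [smul_baseFrame_fst, SO3.coe_mul]
    simp only [PiLp.add_apply, PiLp.smul_apply, smul_baseFrame_fst, smul_baseFrame_snd]
    simp [Matrix.mul_apply, Fin.sum_univ_three, rotZ]
    ring
  · ext i
    rw [smul_baseFrame_snd, SO3.coe_mul]
    simp only [PiLp.add_apply, PiLp.smul_apply, smul_baseFrame_fst, smul_baseFrame_snd]
    simp [Matrix.mul_apply, Fin.sum_univ_three, rotZ]
    ring

theorem IsSphereGeodesicFlow.apply_smul (hφ : IsSphereGeodesicFlow φ) (t : ℝ) (A : SO3)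
    (m : sphereBundle) : φ t (A • m) = A • φ t m := by
  obtain ⟨K, rfl⟩ := exists_smul_baseFrame m
  rw [smul_smul, hφ.smul_baseFrame, hφ.smul_baseFrame, smul_smul, mul_assoc]

theorem IsSphereGeodesicFlow.eq_smul_iff (hφ : IsSphereGeodesicFlow φ) (l : ℝ) (x K : SO3) :
    φ l (K • baseFrame) = x • (K • baseFrame) ↔ x = K * rotZ l * K⁻¹ := by
  rw [hφ.smul_baseFrame, smul_smul, eq_mul_inv_iff_mul_eq]
  exact ⟨fun h => (smul_baseFrame_injective h).symm, fun h => by rw [h]⟩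

theorem IsSphereGeodesicFlow.hasDerivAt (hφ : IsSphereGeodesicFlow φ) (m : sphereBundle)
    (t : ℝ) : HasDerivAt (fun s => (φ s m).1) ((φ t m).1.2, -(φ t m).1.1) t :=
  (hφ.velocity m t).prodMk (hφ.hasDerivAt_snd m t)

/-! ## Tangent spaces of the unit sphere bundle -/

theorem mem_embTangentSpace_of_hasDerivAt {E : Type*} [NormedAddCommGroup E] [NormedSpace ℝ E]
    {M : Set E} {m : M} {c : ℝ → M} {t : ℝ} {w : E} (hc : c t = m)
    (h : HasDerivAt (fun s => (c s : E)) w t) : w ∈ embTangentSpace M m := by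
  refine Submodule.subset_span ⟨fun s => c (t + s), by simpa using hc, ?_⟩
  have h1 : HasDerivAt (fun s => (c s : E)) w (t + 0) := by rwa [add_zero]
  exact h1.comp_const_add t 0

/-- These are the derivatives of the three defining equations; being linear, they pass from
velocities to their span. -/
theorem embTangentSpace_sphereBundle_constraints {m : sphereBundle}
    {w : EuclideanSpace ℝ (Fin 3) × EuclideanSpace ℝ (Fin 3)}
    (hw : w ∈ embTangentSpace sphereBundle m) :
    inner ℝ m.1.1 w.1 = 0 ∧ inner ℝ m.1.2 w.2 = 0 ∧
      inner ℝ m.1.1 w.2 + inner ℝ w.1 m.1.2 = 0 := by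
  induction hw using Submodule.span_induction with
  | mem w hw =>
    obtain ⟨c, rfl, hc⟩ := hw
    have h1 : HasDerivAt (fun t => (c t).1.1) w.1 0 := hc.fst
    have h2 : HasDerivAt (fun t => (c t).1.2) w.2 0 := hc.snd
    have e1 : (fun t => inner ℝ (c t).1.1 (c t).1.1) = fun _ => (1 : ℝ) := funext fun t => by
      rw [real_inner_self_eq_norm_sq, (c t).2.1, one_pow]
    have e2 : (fun t => inner ℝ (c t).1.2 (c t).1.2) = fun _ => (1 : ℝ) := funext fun t => by
      rw [real_inner_self_eq_norm_sq, (c t).2.2.1, one_pow]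
    have e3 : (fun t => inner ℝ (c t).1.1 (c t).1.2) = fun _ => (0 : ℝ) :=
      funext fun t => (c t).2.2.2
    have d1 := h1.inner ℝ h1
    have d2 := h2.inner ℝ h2
    have d3 := h1.inner ℝ h2
    rw [e1] at d1
    rw [e2] at d2
    rw [e3] at d3
    have f1 := d1.unique (hasDerivAt_const 0 1)
    have f2 := d2.unique (hasDerivAt_const 0 1)
    have f3 := d3.unique (hasDerivAt_const 0 0)
    refine ⟨?_, ?_, f3⟩
    · rw [real_inner_comm _ w.1] at f1; linarith
    · rw [real_inner_comm _ w.2] at f2; linarith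
  | zero => simp
  | add a b _ _ ha hb =>
    obtain ⟨a1, a2, a3⟩ := ha
    obtain ⟨b1, b2, b3⟩ := hb
    simp only [Prod.fst_add, Prod.snd_add, inner_add_left, inner_add_right]
    exact ⟨by linarith, by linarith, by linarith⟩
  | smul r a _ ha =>
    obtain ⟨a1, a2, a3⟩ := ha
    simp only [Prod.smul_fst, Prod.smul_snd, inner_smul_right, real_inner_smul_left]
    exact ⟨by rw [a1, mul_zero], by rw [a2, mul_zero], by rw [← mul_add, a3, mul_zero]⟩

namespace SO3

theorem toEuclideanLin_mul (A B : SO3) (v : EuclideanSpace ℝ (Fin 3)) :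
    Matrix.toEuclideanLin (A * B).1 v =
      Matrix.toEuclideanLin A.1 (Matrix.toEuclideanLin B.1 v) := by
  apply PiLp.ext
  simp [Matrix.toLpLin_apply, Matrix.mulVec_mulVec]

/-- The image of the third basis vector. For the frame `A (e₁, e₂) = (p, v)`, this is `p × v`. -/
def normal (A : SO3) : EuclideanSpace ℝ (Fin 3) :=
  Matrix.toEuclideanLin A.1 (EuclideanSpace.single 2 1)

theorem eq_zero_of_inner (A : SO3) {a : EuclideanSpace ℝ (Fin 3)}
    (h0 : inner ℝ (A • baseFrame).1.1 a = 0) (h1 : inner ℝ (A • baseFrame).1.2 a = 0)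
    (h2 : inner ℝ A.normal a = 0) : a = 0 := by
  have ha : a = Matrix.toEuclideanLin A.1 (Matrix.toEuclideanLin (A⁻¹).1 a) := by
    rw [← toEuclideanLin_mul, mul_inv_cancel, coe_one]
    apply PiLp.ext
    simp
  have hz : Matrix.toEuclideanLin (A⁻¹).1 a = 0 := by
    rw [ha] at h0 h1 h2
    rw [smul_fst, inner_apply] at h0
    rw [smul_snd, inner_apply] at h1
    rw [normal, inner_apply] at h2
    simp only [baseFrame, EuclideanSpace.inner_single_left, map_one, one_mul] at h0 h1 h2
    ext i
    fin_cases i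
    · exact h0
    · exact h1
    · exact h2
  rw [ha, hz, map_zero]

theorem norm_normal (A : SO3) : ‖A.normal‖ = 1 := by
  rw [normal, norm_apply]
  simp

theorem inner_normal_fst (A : SO3) : inner ℝ A.normal (A • baseFrame).1.1 = 0 := by
  rw [normal, smul_fst, inner_apply]
  simp [baseFrame, EuclideanSpace.inner_single_left]

theorem inner_normal_snd (A : SO3) : inner ℝ A.normal (A • baseFrame).1.2 = 0 := by
  rw [normal, smul_snd, inner_apply]
  simp [baseFrame, EuclideanSpace.inner_single_left]

theorem toEuclideanLin_normal (x A : SO3) :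
    Matrix.toEuclideanLin x.1 A.normal = (x * A).normal := by
  rw [normal, normal, toEuclideanLin_mul]

theorem normal_mul_rotZ (A : SO3) (l : ℝ) : (A * rotZ l).normal = A.normal := by
  rw [normal, toEuclideanLin_mul, normal]
  congr 1
  ext i
  fin_cases i <;> simp [rotZ]

/-- The map `(a, b) ↦ (⟨n, a⟩, ⟨n, b⟩)`, where `n` is the normal vector of `A`. -/
def normalPart (A : SO3) :
    (EuclideanSpace ℝ (Fin 3) × EuclideanSpace ℝ (Fin 3)) →ₗ[ℝ] (Fin 2 → ℝ) :=
  LinearMap.pi ![(innerₛₗ ℝ A.normal) ∘ₗ LinearMap.fst ℝ _ _,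
    (innerₛₗ ℝ A.normal) ∘ₗ LinearMap.snd ℝ _ _]

theorem normalPart_zero (A : SO3) (w : EuclideanSpace ℝ (Fin 3) × EuclideanSpace ℝ (Fin 3)) :
    A.normalPart w 0 = inner ℝ A.normal w.1 := rfl

theorem normalPart_one (A : SO3) (w : EuclideanSpace ℝ (Fin 3) × EuclideanSpace ℝ (Fin 3)) :
    A.normalPart w 1 = inner ℝ A.normal w.2 := rfl

/-- The restriction of `normalPart` to the tangent space at `A (e₁, e₂)`. -/
def tangentNormalPart (A : SO3) :
    embTangentSpace sphereBundle (A • baseFrame) →ₗ[ℝ] (Fin 2 → ℝ) :=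
  A.normalPart ∘ₗ (embTangentSpace sphereBundle (A • baseFrame)).subtype

end SO3

theorem norm_cos_smul_add_sin_smul {p n : EuclideanSpace ℝ (Fin 3)} (hp : ‖p‖ = 1) (hn : ‖n‖ = 1)
    (hpn : inner ℝ n p = 0) (t : ℝ) : ‖Real.cos t • p + Real.sin t • n‖ = 1 := by
  have hp' : inner ℝ p p = (1 : ℝ) := by rw [real_inner_self_eq_norm_sq, hp, one_pow]
  have hn' : inner ℝ n n = (1 : ℝ) := by rw [real_inner_self_eq_norm_sq, hn, one_pow]
  have hnp : inner ℝ p n = (0 : ℝ) := by rw [real_inner_comm, hpn]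
  rw [norm_eq_sqrt_real_inner, Real.sqrt_eq_one]
  simp only [inner_add_left, inner_add_right, real_inner_smul_left, real_inner_smul_right, hp', hn',
    hpn, hnp]
  linear_combination Real.cos_sq_add_sin_sq t

theorem hasDerivAt_cos_smul_add_sin_smul (p n : EuclideanSpace ℝ (Fin 3)) :
    HasDerivAt (fun t => Real.cos t • p + Real.sin t • n) n 0 := by
  refine (((Real.hasDerivAt_cos 0).smul_const p).add
    ((Real.hasDerivAt_sin 0).smul_const n)).congr_deriv ?_
  simp

namespace SO3

/-- Turning `p` towards the normal while keeping `v` stays in the bundle, because both are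
orthogonal to `v`. The next lemma turns `v` instead. -/
theorem normal_fst_mem (A : SO3) :
    (A.normal, (0 : EuclideanSpace ℝ (Fin 3))) ∈ embTangentSpace sphereBundle (A • baseFrame) := by
  obtain ⟨h1, h2, h3⟩ := (A • baseFrame).2
  have h (t : ℝ) : (Real.cos t • (A • baseFrame).1.1 + Real.sin t • A.normal,
      (A • baseFrame).1.2) ∈ sphereBundle := by
    refine ⟨norm_cos_smul_add_sin_smul h1 A.norm_normal A.inner_normal_fst t, h2, ?_⟩
    simp only [inner_add_left, real_inner_smul_left, h3, A.inner_normal_snd]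
    simp
  refine mem_embTangentSpace_of_hasDerivAt (t := 0) (c := fun t => ⟨_, h t⟩) ?_ ?_
  · apply Subtype.ext
    apply Prod.ext <;> simp
  · exact (hasDerivAt_cos_smul_add_sin_smul _ _).prodMk (hasDerivAt_const _ _)

theorem normal_snd_mem (A : SO3) :
    ((0 : EuclideanSpace ℝ (Fin 3)), A.normal) ∈ embTangentSpace sphereBundle (A • baseFrame) := by
  obtain ⟨h1, h2, h3⟩ := (A • baseFrame).2
  have h (t : ℝ) : ((A • baseFrame).1.1,
      Real.cos t • (A • baseFrame).1.2 + Real.sin t • A.normal) ∈ sphereBundle := by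
    refine ⟨h1, norm_cos_smul_add_sin_smul h2 A.norm_normal A.inner_normal_snd t, ?_⟩
    have h4 : inner ℝ (A • baseFrame).1.1 A.normal = 0 := by
      rw [real_inner_comm, A.inner_normal_fst]
    simp only [inner_add_right, real_inner_smul_right, h3, h4]
    simp
  refine mem_embTangentSpace_of_hasDerivAt (t := 0) (c := fun t => ⟨_, h t⟩) ?_ ?_
  · apply Subtype.ext
    apply Prod.ext <;> simp
  · exact (hasDerivAt_const _ _).prodMk (hasDerivAt_cos_smul_add_sin_smul _ _)

theorem tangentNormalPart_surjective (A : SO3) : Function.Surjective A.tangentNormalPart := by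
  intro z
  refine ⟨z 0 • ⟨_, A.normal_fst_mem⟩ + z 1 • ⟨_, A.normal_snd_mem⟩, ?_⟩
  ext i
  fin_cases i
  · simp [tangentNormalPart, normalPart_zero, inner_smul_right, norm_normal]
  · simp [tangentNormalPart, normalPart_one, inner_smul_right, norm_normal]

end SO3

/-! ## Linearised Poincaré maps -/

theorem IsSphereGeodesicFlow.flowGenerator_eq (hφ : IsSphereGeodesicFlow φ) (m : sphereBundle) :
    flowGenerator φ m = (m.1.2, -m.1.1) := by
  have h := (hφ.hasDerivAt m 0).deriv
  rw [hφ.map_zero] at h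
  exact h

/-- Without normal components, the tangency constraints leave only multiples of `v` and `-p`, and
the mixed constraint forces the two coefficients to agree, which is the direction of `u = (v, -p)`.
-/
theorem IsSphereGeodesicFlow.flowLine_eq_ker (hφ : IsSphereGeodesicFlow φ) (A : SO3) :
    flowLine φ (A • baseFrame) = A.tangentNormalPart.ker := by
  ext w
  obtain ⟨h1, h2, h3⟩ := (A • baseFrame).2
  have hp : inner ℝ (A • baseFrame).1.1 (A • baseFrame).1.1 = (1 : ℝ) := by
    rw [real_inner_self_eq_norm_sq, h1, one_pow]
  have h3' : inner ℝ (A • baseFrame).1.2 (A • baseFrame).1.1 = (0 : ℝ) := by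
    rw [real_inner_comm, h3]
  rw [flowLine, Submodule.submoduleOf, Submodule.mem_comap, Submodule.mem_span_singleton, hφ.flowGenerator_eq,
    LinearMap.mem_ker]
  constructor
  · rintro ⟨r, hr⟩
    have hr1 : w.1.1 = r • (A • baseFrame).1.2 := (congrArg Prod.fst hr).symm
    have hr2 : w.1.2 = r • -(A • baseFrame).1.1 := (congrArg Prod.snd hr).symm
    ext i
    fin_cases i
    · simp [SO3.tangentNormalPart, SO3.normalPart_zero, hr1, inner_smul_right, A.inner_normal_snd]
    · simp [SO3.tangentNormalPart, SO3.normalPart_one, hr2, inner_smul_right, A.inner_normal_fst]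
  · intro hw
    have n0 : inner ℝ A.normal w.1.1 = 0 := congrFun hw 0
    have n1 : inner ℝ A.normal w.1.2 = 0 := congrFun hw 1
    obtain ⟨c1, c2, c3⟩ := embTangentSpace_sphereBundle_constraints w.2
    refine ⟨inner ℝ (A • baseFrame).1.2 w.1.1, ?_⟩
    have e1 : w.1.1 - (inner ℝ (A • baseFrame).1.2 w.1.1 : ℝ) • (A • baseFrame).1.2 = 0 := by
      apply A.eq_zero_of_inner <;>
        simp [inner_sub_right, inner_smul_right, c1, h2, h3, n0, A.inner_normal_snd]
    have e2 : w.1.2 + (inner ℝ (A • baseFrame).1.2 w.1.1 : ℝ) • (A • baseFrame).1.1 = 0 := by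
      apply A.eq_zero_of_inner
      · rw [inner_add_right, inner_smul_right, hp]
        rw [real_inner_comm w.1.1]
        linarith
      · simp [inner_add_right, inner_smul_right, c2, h3']
      · simp [inner_add_right, inner_smul_right, n1, A.inner_normal_fst]
    refine Prod.ext ?_ ?_
    · exact (sub_eq_zero.mp e1).symm
    · rw [Prod.smul_snd, smul_neg]
      exact (eq_neg_of_add_eq_zero_left e2).symm

/-- The linear map of the ambient space that restricts to `φ_l ∘ x⁻¹`. -/
def ambientReturnMap (x : SO3) (l : ℝ) :
    (EuclideanSpace ℝ (Fin 3) × EuclideanSpace ℝ (Fin 3)) →ₗ[ℝ]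
      (EuclideanSpace ℝ (Fin 3) × EuclideanSpace ℝ (Fin 3)) :=
  LinearMap.prod
    (Real.cos l • Matrix.toEuclideanLin (x⁻¹).1 ∘ₗ LinearMap.fst ℝ _ _
      + Real.sin l • Matrix.toEuclideanLin (x⁻¹).1 ∘ₗ LinearMap.snd ℝ _ _)
    (-Real.sin l • Matrix.toEuclideanLin (x⁻¹).1 ∘ₗ LinearMap.fst ℝ _ _
      + Real.cos l • Matrix.toEuclideanLin (x⁻¹).1 ∘ₗ LinearMap.snd ℝ _ _)

theorem IsSphereGeodesicFlow.coe_returnMap (hφ : IsSphereGeodesicFlow φ) (x : SO3) (l : ℝ)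
    (m : sphereBundle) : (φ l (x⁻¹ • m)).1 = ambientReturnMap x l m.1 := by
  rw [hφ.coe_apply]
  rfl

theorem IsSphereGeodesicFlow.hasDerivAt_returnMap (hφ : IsSphereGeodesicFlow φ) (x : SO3) (l : ℝ)
    {c : ℝ → sphereBundle} {w : EuclideanSpace ℝ (Fin 3) × EuclideanSpace ℝ (Fin 3)}
    (hc : HasDerivAt (fun t => (c t).1) w 0) :
    HasDerivAt (fun t => (φ l (x⁻¹ • c t)).1) (ambientReturnMap x l w) 0 := by
  simp only [hφ.coe_returnMap]
  exact (LinearMap.toContinuousLinearMap (ambientReturnMap x l)).hasFDerivAt.comp_hasDerivAt 0 hc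

/-- The normal is the axis of the rotation `x`, so pairing with it ignores `x⁻¹` and sees only the
coefficients of the flow. -/
theorem normalPart_ambientReturnMap {x A : SO3} {l : ℝ} (hx : x = A * rotZ l * A⁻¹)
    (w : EuclideanSpace ℝ (Fin 3) × EuclideanSpace ℝ (Fin 3)) :
    A.normalPart (ambientReturnMap x l w) =
      Matrix.toLin' !![Real.cos l, Real.sin l; -Real.sin l, Real.cos l] (A.normalPart w) := by
  have hn : A.normal = Matrix.toEuclideanLin (x⁻¹).1 A.normal := by
    rw [SO3.toEuclideanLin_normal]
    have : x⁻¹ * A = A * rotZ (-l) := by rw [hx, rotZ_neg]; group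
    rw [this, SO3.normal_mul_rotZ]
  have hi : ∀ a, inner ℝ A.normal (Matrix.toEuclideanLin (x⁻¹).1 a) = inner ℝ A.normal a := by
    intro a
    conv_lhs => rw [hn]
    rw [SO3.inner_apply]
  ext i
  fin_cases i
  · simp [SO3.normalPart_zero, SO3.normalPart_one, ambientReturnMap, inner_add_right,
      inner_smul_right, hi, Matrix.mulVec, dotProduct, Fin.sum_univ_two]
  · simp [SO3.normalPart_zero, SO3.normalPart_one, ambientReturnMap, inner_add_right,
      inner_smul_right, hi, Matrix.mulVec, dotProduct, Fin.sum_univ_two]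

theorem IsSphereGeodesicFlow.exists_isPoincareMap (hφ : IsSphereGeodesicFlow φ) {x A : SO3} {l : ℝ}
    (hx : x = A * rotZ l * A⁻¹) : ∃ P, IsPoincareMap φ x l (A • baseFrame) P := by
  have hfix : φ l (x⁻¹ • (A • baseFrame)) = A • baseFrame := by
    rw [hφ.apply_smul, (hφ.eq_smul_iff l x A).mpr hx, inv_smul_smul]
  -- The return map sends curves through the fixed point to such curves, so its ambient linear
  -- extension preserves the span of their velocities.
  have hmem : ∀ w ∈ embTangentSpace sphereBundle (A • baseFrame),
      ambientReturnMap x l w ∈ embTangentSpace sphereBundle (A • baseFrame) := by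
    intro w hw
    induction hw using Submodule.span_induction with
    | mem w hw =>
      obtain ⟨c, hc0, hc⟩ := hw
      exact mem_embTangentSpace_of_hasDerivAt (c := fun t => φ l (x⁻¹ • c t)) (t := 0)
        (by rw [hc0, hfix]) (hφ.hasDerivAt_returnMap x l hc)
    | zero => rw [_root_.map_zero]; exact Submodule.zero_mem _
    | add a b _ _ ha hb => rw [map_add]; exact Submodule.add_mem _ ha hb
    | smul r a _ ha => rw [map_smul]; exact Submodule.smul_mem _ r ha
  let B := (ambientReturnMap x l).restrict hmem
  have hline : flowLine φ (A • baseFrame) ≤ (flowLine φ (A • baseFrame)).comap B := by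
    rw [hφ.flowLine_eq_ker]
    intro w hw
    rw [Submodule.mem_comap, LinearMap.mem_ker]
    rw [LinearMap.mem_ker] at hw
    change A.normalPart (ambientReturnMap x l w.1) = 0
    change A.normalPart w.1 = 0 at hw
    rw [normalPart_ambientReturnMap hx, hw, _root_.map_zero]
  exact ⟨Submodule.mapQ _ _ B hline, B, fun c w _ hc => hφ.hasDerivAt_returnMap x l hc,
    fun w => rfl⟩

/-- Velocities span the tangent space, so the differential is unique and equals the ambient map
there. The determinant is thus the same for every admissible `P`, including the one chosen in
`poincareSign`; it is computed as `(1 - cos l)² + sin² l`. -/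
theorem IsSphereGeodesicFlow.det_isPoincareMap (hφ : IsSphereGeodesicFlow φ) {x A : SO3} {l : ℝ}
    (hx : x = A * rotZ l * A⁻¹)
    {P : (embTangentSpace sphereBundle (A • baseFrame) ⧸ flowLine φ (A • baseFrame)) →ₗ[ℝ]
      (embTangentSpace sphereBundle (A • baseFrame) ⧸ flowLine φ (A • baseFrame))}
    (hP : IsPoincareMap φ x l (A • baseFrame) P) :
    LinearMap.det (P - 1) = 2 - 2 * Real.cos l ∧ LinearMap.det (1 - P) = 2 - 2 * Real.cos l := by
  obtain ⟨B, hB, hPB⟩ := hP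
  have hBw : ∀ w (hw : w ∈ embTangentSpace sphereBundle (A • baseFrame)),
      (B ⟨w, hw⟩ : EuclideanSpace ℝ (Fin 3) × EuclideanSpace ℝ (Fin 3))
        = ambientReturnMap x l w := by
    intro w hw
    induction hw using Submodule.span_induction with
    | mem w hw =>
      obtain ⟨c, hc0, hc⟩ := hw
      exact (hB c ⟨w, Submodule.subset_span ⟨c, hc0, hc⟩⟩ hc0 hc).unique
        (hφ.hasDerivAt_returnMap x l hc)
    | zero => exact (congrArg Subtype.val (_root_.map_zero B)).trans (_root_.map_zero _).symm
    | add a b ha' hb' ha hb =>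
      exact (congrArg Subtype.val (map_add B ⟨a, ha'⟩ ⟨b, hb'⟩)).trans
        ((congrArg₂ (· + ·) ha hb).trans (map_add _ a b).symm)
    | smul r a ha' ha =>
      exact (congrArg Subtype.val (map_smul B r ⟨a, ha'⟩)).trans
        ((congrArg (r • ·) ha).trans (map_smul _ r a).symm)
  let R := Matrix.toLin' !![Real.cos l, Real.sin l; -Real.sin l, Real.cos l]
  let e : (embTangentSpace sphereBundle (A • baseFrame) ⧸ flowLine φ (A • baseFrame)) ≃ₗ[ℝ]
      (Fin 2 → ℝ) :=
    (Submodule.quotEquivOfEq _ _ (hφ.flowLine_eq_ker A)).trans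
      (A.tangentNormalPart.quotKerEquivOfSurjective A.tangentNormalPart_surjective)
  have he : ∀ w, e ((flowLine φ (A • baseFrame)).mkQ w) = A.normalPart w.1 := fun w => rfl
  have heP : ∀ q, e (P q) = R (e q) := by
    intro q
    obtain ⟨w, rfl⟩ := (flowLine φ (A • baseFrame)).mkQ_surjective q
    rw [hPB, he, he, hBw, normalPart_ambientReturnMap hx]
  have h1 : (e : _ →ₗ[ℝ] _) ∘ₗ (P - 1) ∘ₗ (e.symm : _ →ₗ[ℝ] _) = R - 1 := by
    refine LinearMap.ext fun z => ?_
    change e (P (e.symm z) - e.symm z) = R z - z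
    rw [map_sub, heP, e.apply_symm_apply]
  have h2 : (e : _ →ₗ[ℝ] _) ∘ₗ (1 - P) ∘ₗ (e.symm : _ →ₗ[ℝ] _) = 1 - R := by
    refine LinearMap.ext fun z => ?_
    change e (e.symm z - P (e.symm z)) = z - R z
    rw [map_sub, heP, e.apply_symm_apply]
  have hs := Real.cos_sq_add_sin_sq l
  have hone : (1 : (Fin 2 → ℝ) →ₗ[ℝ] (Fin 2 → ℝ)) = Matrix.toLin' 1 := by
    rw [Matrix.toLin'_one]; rfl
  rw [← LinearMap.det_conj (P - 1) e, ← LinearMap.det_conj (1 - P) e, h1, h2, hone, ← map_sub,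
    ← map_sub, LinearMap.det_toLin', LinearMap.det_toLin', Matrix.det_fin_two, Matrix.det_fin_two]
  simp
  constructor <;> linear_combination hs

theorem IsSphereGeodesicFlow.poincareSign_eq_one (hφ : IsSphereGeodesicFlow φ) {x A : SO3} {l : ℝ}
    (hx : x = A * rotZ l * A⁻¹) (hl : Real.cos l ≠ 1) :
    poincareSign φ x l (A • baseFrame) = 1 := by
  have h := hφ.exists_isPoincareMap hx
  rw [poincareSign, dif_pos h, (hφ.det_isPoincareMap hx h.choose_spec).2]
  apply Real.sign_of_pos
  have := lt_of_le_of_ne (Real.cos_le_one l) hl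
  linarith

/-- The geodesic flow is `x`-nondegenerate if and only if every return time `l ≠ 0` satisfies
`cos l ≠ 1`. -/
theorem IsSphereGeodesicFlow.isNondegenerateFlow_iff (hφ : IsSphereGeodesicFlow φ) (x : SO3) :
    IsNondegenerateFlow φ x ↔
      ∀ (l : ℝ) (A : SO3), l ≠ 0 → x = A * rotZ l * A⁻¹ → Real.cos l ≠ 1 := by
  constructor
  · intro h l A hl hx hc
    obtain ⟨P, hP, hd⟩ := h l (A • baseFrame) hl ((hφ.eq_smul_iff l x A).mpr hx)
    apply hd
    rw [(hφ.det_isPoincareMap hx hP).1, hc]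
    norm_num
  · intro h l m hl hm
    obtain ⟨A, rfl⟩ := exists_smul_baseFrame m
    have hx := (hφ.eq_smul_iff l x A).mp hm
    obtain ⟨P, hP⟩ := hφ.exists_isPoincareMap hx
    refine ⟨P, hP, ?_⟩
    rw [(hφ.det_isPoincareMap hx hP).1]
    intro h0
    exact h l A hl hx (by linarith)

/-! ## Holonomy of the trivial connection -/

theorem holonomyMap_trivial (hφ : IsSphereGeodesicFlow φ) {γ : ℝ → sphereBundle}
    (hγ : ∀ t, γ t = φ t (γ 0)) (l : ℝ) :
    LinearMap.trace ℂ ℂ (holonomyMap (trivialLineConnection sphereBundle) γ l) = 1 := by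
  have hex : ∃ T : ℂ →ₗ[ℂ] ℂ, ∀ s : ℝ → ℂ,
      IsParallelAlong (trivialLineConnection sphereBundle) γ s → T (s 0) = s (-l) := by
    refine ⟨LinearMap.id, fun s hs => ?_⟩
    have hd : ∀ t, HasDerivAt s 0 t := by
      intro t
      obtain ⟨w, _, h⟩ := hs t
      simpa [trivialLineConnection] using h
    exact is_const_of_deriv_eq_zero (fun t => (hd t).differentiableAt) (fun t => (hd t).deriv) _ _
  -- Transport is a chosen linear map, so a parallel section with nonzero value is needed to pin it
  -- down; differentiability of the flow curve makes the constant `1` one.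
  have hpar : IsParallelAlong (trivialLineConnection sphereBundle) γ fun _ => 1 := by
    intro t
    have h1 : HasDerivAt (fun r => (γ r).1) ((φ t (γ 0)).1.2, -(φ t (γ 0)).1.1) t := by
      have : (fun r => (γ r).1) = fun r => (φ r (γ 0)).1 := funext fun r => by rw [hγ r]
      rw [this]
      exact hφ.hasDerivAt (γ 0) t
    exact ⟨⟨_, mem_embTangentSpace_of_hasDerivAt rfl h1⟩, h1, by
      simpa [trivialLineConnection] using hasDerivAt_const t (1 : ℂ)⟩
  have hid : holonomyMap (trivialLineConnection sphereBundle) γ l = LinearMap.id := by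
    rw [holonomyMap, LinearMap.id_comp, parallelTransport, dif_pos hex]
    ext
    exact hex.choose_spec _ hpar
  rw [hid, LinearMap.trace_id]
  simp

/-! ## Primitive periods -/

open scoped Pointwise in
-- Times with equal image differ by `Tℤ`. So covering the image means that almost every time has a
-- translate in `I`, and injectivity off `N` confines overlaps of translates to translates of `N`.
theorem isAddFundamentalDomain_of_isFundamentalInterval {X : Type*} {γ : ℝ → X} {T : ℝ}
    (hγ : ∀ s t, γ s = γ t ↔ ∃ n : ℤ, n • T + t = s) {I : Set ℝ}
    (hI : IsFundamentalInterval γ I) :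
    IsAddFundamentalDomain (AddSubgroup.zmultiples T) I volume := by
  obtain ⟨hord, ⟨N, hN, hinj⟩, hcov⟩ := hI
  refine ⟨hord.measurableSet.nullMeasurableSet, ?_, ?_⟩
  · filter_upwards [measure_eq_zero_iff_ae_notMem.mp hcov] with x hx
    simp only [not_not] at hx
    obtain ⟨y, hy, hxy⟩ := hx
    obtain ⟨n, rfl⟩ := (hγ y x).mp hxy
    exact ⟨⟨n • T, n, rfl⟩, hy⟩
  · intro a b hab
    have hsub : (a +ᵥ I) ∩ (b +ᵥ I) ⊆ (a +ᵥ N) ∪ (b +ᵥ N) := by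
      rintro x ⟨⟨y, hy, rfl⟩, ⟨z, hz, hyz⟩⟩
      by_contra hx
      rw [Set.mem_union, not_or] at hx
      have hyN : y ∉ N := fun h => hx.1 ⟨y, h, rfl⟩
      have hzN : z ∉ N := fun h => hx.2 ⟨z, h, hyz⟩
      have hyz' : (b : ℝ) + z = a + y := hyz
      obtain ⟨n, hn⟩ : (b : ℝ) - a ∈ AddSubgroup.zmultiples T :=
        AddSubgroup.sub_mem _ b.2 a.2
      have hn' : n • T = (b : ℝ) - a := hn
      have hγyz : γ y = γ z := (hγ y z).mpr ⟨n, by rw [hn']; linarith⟩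
      have := hinj ⟨hy, hyN⟩ ⟨hz, hzN⟩ hγyz
      exact hab (Subtype.ext (by linarith))
    refine measure_mono_null hsub (measure_union_null ?_ ?_)
    · rw [measure_vadd, hN]
    · rw [measure_vadd, hN]

/-- A `T`-periodic function has the same integral over all fundamental domains of `Tℤ`, so the
chosen interval may be replaced by `(0, T]`. -/
theorem primitivePeriod_eq_intervalIntegral {X : Type*} (χ : X → ℝ) {γ : ℝ → X} {T : ℝ}
    (hT : 0 < T) (hγ : ∀ s t, γ s = γ t ↔ ∃ n : ℤ, n • T + t = s) :
    primitivePeriod χ γ = ∫ s in (0 : ℝ)..T, χ (γ s) := by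
  have hex : ∃ I, IsFundamentalInterval γ I := by
    refine ⟨Set.Ioc 0 (0 + T), Set.ordConnected_Ioc, ⟨∅, measure_empty, ?_⟩, ?_⟩
    · rintro s ⟨hs, _⟩ t ⟨ht, _⟩ hst
      obtain ⟨n, rfl⟩ := (hγ s t).mp hst
      obtain ⟨m, _, hm⟩ := existsUnique_add_zsmul_mem_Ioc hT t 0
      have h1 := hm n (by simpa [add_comm] using hs)
      have h2 := hm 0 (by simpa using ht)
      rw [h1, ← h2, zero_smul, zero_add]
    · convert measure_empty (μ := (volume : Measure ℝ))
      rw [Set.eq_empty_iff_forall_notMem]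
      intro t ht
      obtain ⟨m, hm, _⟩ := existsUnique_add_zsmul_mem_Ioc hT t 0
      exact ht ⟨_, hm, (hγ _ _).mpr ⟨m, add_comm _ _⟩⟩
  have hI := Classical.epsilon_spec hex
  rw [primitivePeriod, intervalIntegral.integral_of_le hT.le]
  have h := (isAddFundamentalDomain_of_isFundamentalInterval hγ hI).setIntegral_eq
    (isAddFundamentalDomain_Ioc hT 0) (f := fun s => χ (γ s)) ?_
  · rw [zero_add] at h
    exact h
  · rintro ⟨_, n, rfl⟩ x
    exact congrArg χ ((hγ _ _).mpr ⟨n, rfl⟩)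

/-- The integral of `χ` over the flow curve through `A (e₁, e₂)`. -/
def flowCurveIntegral (χ : sphereBundle → ℝ) (A : SO3) : ℝ :=
  ∫ s in (0 : ℝ)..(2 * Real.pi), χ ((A * rotZ s) • baseFrame)

/-- Right multiplication by a rotation is a time shift of a `2π`-periodic curve. -/
theorem flowCurveIntegral_mul_rotZ (χ : sphereBundle → ℝ) (A : SO3) (a : ℝ) :
    flowCurveIntegral χ (A * rotZ a) = flowCurveIntegral χ A := by
  have hper : Function.Periodic (fun s => χ ((A * rotZ s) • baseFrame)) (2 * Real.pi) := by
    intro s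
    have := rotZ_add_int_mul_two_pi s 1
    rw [Int.cast_one, one_mul] at this
    simp only [this]
  have h1 := hper.intervalIntegral_add_eq a 0
  rw [zero_add] at h1
  rw [flowCurveIntegral, flowCurveIntegral, ← h1]
  have h2 := intervalIntegral.integral_comp_add_left (a := 0) (b := 2 * Real.pi)
    (fun s => χ ((A * rotZ s) • baseFrame)) a
  rw [add_zero] at h2
  rw [← h2]
  simp only [rotZ_add, mul_assoc]

/-! ## Periodic orbits of the geodesic flow -/

theorem IsSphereGeodesicFlow.primitivePeriod_eq (hφ : IsSphereGeodesicFlow φ)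
    (χ : sphereBundle → ℝ) {γ : ℝ → sphereBundle} (hγ : ∀ t, γ t = φ t (γ 0)) {A : SO3}
    (hA : γ 0 = A • baseFrame) : primitivePeriod χ γ = flowCurveIntegral χ A := by
  have hγ' : γ = fun t => (A * rotZ t) • baseFrame := funext fun t => by
    rw [hγ, hA, hφ.smul_baseFrame]
  rw [primitivePeriod_eq_intervalIntegral χ Real.two_pi_pos, hγ', flowCurveIntegral]
  intro s t
  simp only [hγ']
  constructor
  · intro h
    have h1 := mul_left_cancel (smul_baseFrame_injective h)
    have h2 : rotZ (s - t) = 1 := by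
      rw [sub_eq_add_neg, rotZ_add, rotZ_neg, h1, mul_inv_cancel]
    obtain ⟨n, hn⟩ := (rotZ_eq_one_iff _).mp h2
    exact ⟨n, by rw [zsmul_eq_mul, hn]; ring⟩
  · rintro ⟨n, rfl⟩
    rw [zsmul_eq_mul, add_comm, rotZ_add_int_mul_two_pi]

/-- If `B` is the initial frame, `A⁻¹ * B` commutes with `rotZ l` and hence lies in the torus. -/
theorem IsSphereGeodesicFlow.exists_rotZ_of_periodic (hφ : IsSphereGeodesicFlow φ) {x A : SO3}
    {l : ℝ} (hx : x = A * rotZ l * A⁻¹) (hl : Real.sin l ≠ 0) (γ : PeriodicFlowCurve φ x l) :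
    ∃ s, γ.1 0 = (A * rotZ s) • baseFrame := by
  obtain ⟨B, hB⟩ := exists_smul_baseFrame (γ.1 0)
  have h1 : φ l (B • baseFrame) = x • B • baseFrame := by rw [hB, ← γ.2.1, γ.2.2]
  rw [hφ.eq_smul_iff, hx] at h1
  obtain ⟨s, hs⟩ := exists_rotZ_of_commute (K := A⁻¹ * B) hl (by
    have h2 : rotZ l = A⁻¹ * (B * rotZ l * B⁻¹) * A := by rw [← h1]; group
    calc A⁻¹ * B * rotZ l = A⁻¹ * (B * rotZ l * B⁻¹) * A * (A⁻¹ * B) := by group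
      _ = rotZ l * (A⁻¹ * B) := by rw [← h2])
  exact ⟨s, by rw [← hs, mul_inv_cancel_left, hB]⟩

theorem IsSphereGeodesicFlow.subsingleton_periodicOrbits (hφ : IsSphereGeodesicFlow φ) {x A : SO3}
    {l : ℝ} (hx : x = A * rotZ l * A⁻¹) (hl : Real.sin l ≠ 0) :
    Subsingleton (PeriodicOrbits φ x l) := by
  refine ⟨fun a b => ?_⟩
  induction a using Quotient.inductionOn with | _ γ =>
  induction b using Quotient.inductionOn with | _ γ' =>
  obtain ⟨s, hs⟩ := hφ.exists_rotZ_of_periodic hx hl γ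
  obtain ⟨s', hs'⟩ := hφ.exists_rotZ_of_periodic hx hl γ'
  refine Quotient.sound ⟨s' - s, fun t => ?_⟩
  rw [γ.2.1 (t + (s' - s)), γ'.2.1, hs, hs', hφ.smul_baseFrame, hφ.smul_baseFrame, mul_assoc,
    mul_assoc, ← rotZ_add, ← rotZ_add]
  congr 3
  ring

theorem IsSphereGeodesicFlow.nonempty_periodicOrbits (hφ : IsSphereGeodesicFlow φ) {x A : SO3}
    {l : ℝ} (hx : x = A * rotZ l * A⁻¹) : Nonempty (PeriodicOrbits φ x l) := by
  refine ⟨Quotient.mk _ ⟨fun t => φ t (A • baseFrame), fun t => ?_, ?_⟩⟩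
  · simp only [hφ.map_zero]
  · simp only [hφ.map_zero]
    exact (hφ.eq_smul_iff l x A).mpr hx

theorem IsSphereGeodesicFlow.orbitWeight_eq (hφ : IsSphereGeodesicFlow φ) {x A : SO3}
    {l : ℝ} (hx : x = A * rotZ l * A⁻¹) (hl : Real.sin l ≠ 0) (χ : sphereBundle → ℝ)
    (γ : PeriodicOrbits φ x l) :
    orbitWeight φ (trivialLineConnection sphereBundle) χ x l γ = (flowCurveIntegral χ A : ℂ) := by
  obtain ⟨s, hs⟩ := hφ.exists_rotZ_of_periodic hx hl (Quotient.out γ)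
  have hγ := (Quotient.out γ).2.1
  -- The representative may start elsewhere on the orbit; rotations about one axis commute, so its
  -- frame presents the same `x`.
  have hx' : x = A * rotZ s * rotZ l * (A * rotZ s)⁻¹ := by
    have hc : rotZ s * rotZ l = rotZ l * rotZ s := by rw [← rotZ_add, add_comm, rotZ_add]
    rw [hx, mul_assoc A (rotZ s), hc]
    group
  have hc : Real.cos l ≠ 1 := by
    intro h
    apply hl
    have := Real.sin_sq_add_cos_sq l
    rw [h] at this
    nlinarith
  rw [orbitWeight]
  simp only [holonomyMap_trivial hφ hγ, hφ.primitivePeriod_eq χ hγ hs, flowCurveIntegral_mul_rotZ]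
  rw [hs, hφ.poincareSign_eq_one hx' hc]
  simp

theorem IsSphereGeodesicFlow.hasSum_orbitWeight (hφ : IsSphereGeodesicFlow φ) {x A : SO3}
    {l : ℝ} (hx : x = A * rotZ l * A⁻¹) (hl : Real.sin l ≠ 0) (χ : sphereBundle → ℝ) :
    HasSum (orbitWeight φ (trivialLineConnection sphereBundle) χ x l)
      (flowCurveIntegral χ A : ℂ) := by
  have := hφ.subsingleton_periodicOrbits hx hl
  obtain ⟨γ⟩ := hφ.nonempty_periodicOrbits hx
  rw [← hφ.orbitWeight_eq hx hl χ γ]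
  exact hasSum_single γ fun γ' h => absurd (Subsingleton.elim γ' γ) h

/-! ## The length spectrum -/

/-- The coefficient `e^{-|l|σ} / |l|` for `l = θ + 2πn`. -/
def lengthCoeff (σ : ℂ) (θ : ℝ) (n : ℤ) : ℂ :=
  Complex.exp (-((|θ + 2 * Real.pi * n| : ℝ) : ℂ) * σ) / ((|θ + 2 * Real.pi * n| : ℝ) : ℂ)

theorem sin_add_two_pi_mul_int (θ : ℝ) (n : ℤ) :
    Real.sin (θ + 2 * Real.pi * n) = Real.sin θ := by
  rw [mul_comm, Real.sin_add_int_mul_two_pi]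

theorem rotZ_add_two_pi_mul_int (θ : ℝ) (n : ℤ) : rotZ (θ + 2 * Real.pi * n) = rotZ θ := by
  rw [mul_comm, rotZ_add_int_mul_two_pi]

theorem IsSphereGeodesicFlow.lengthTerm_eq (hφ : IsSphereGeodesicFlow φ) {x A : SO3}
    {θ : ℝ} (hx : x = A * rotZ θ * A⁻¹) (hθ : Real.sin θ ≠ 0) (χ : sphereBundle → ℝ) (σ : ℂ)
    (n : ℤ) :
    lengthTerm φ (trivialLineConnection sphereBundle) χ σ x (θ + 2 * Real.pi * n) =
      lengthCoeff σ θ n * (flowCurveIntegral χ A : ℂ) := by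
  rw [lengthTerm, lengthCoeff,
    (hφ.hasSum_orbitWeight (by rw [rotZ_add_two_pi_mul_int, hx])
      (by rwa [sin_add_two_pi_mul_int]) χ).tsum_eq]

theorem summable_lengthCoeff {σ : ℂ} (hσ : 0 < σ.re) {θ : ℝ} (hθ : Real.sin θ ≠ 0) :
    Summable (lengthCoeff σ θ) := by
  have hgeo : Summable fun n : ℕ => Real.exp (-(2 * Real.pi * σ.re)) ^ n :=
    summable_geometric_of_lt_one (Real.exp_pos _).le
      (Real.exp_lt_one_iff.mpr (by nlinarith [mul_pos Real.pi_pos hσ]))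
  -- The majorant uses `|sin θ| = |sin l| ≤ |l|` for the denominators and `|l| ≥ 2π|n| - |θ|` for
  -- the exponents.
  have hmaj : Summable fun n : ℤ =>
      Real.exp (|θ| * σ.re) / |Real.sin θ| * Real.exp (-(2 * Real.pi * σ.re)) ^ n.natAbs := by
    refine Summable.mul_left _ (Summable.of_nat_of_neg ?_ ?_)
    · simpa using hgeo
    · simpa using hgeo
  refine Summable.of_norm_bounded hmaj fun n => ?_
  have hs : 0 < |Real.sin θ| := abs_pos.mpr hθ
  have h1 : |Real.sin θ| ≤ |θ + 2 * Real.pi * n| := by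
    rw [← sin_add_two_pi_mul_int θ n]
    exact Real.abs_sin_le_abs
  have h2 : 2 * Real.pi * (n.natAbs : ℝ) - |θ| ≤ |θ + 2 * Real.pi * n| := by
    have h3 : |2 * Real.pi * (n : ℝ)| = 2 * Real.pi * (n.natAbs : ℝ) := by
      rw [abs_mul, abs_of_pos Real.two_pi_pos, Nat.cast_natAbs, Int.cast_abs]
    rw [← h3]
    have := abs_sub_abs_le_abs_sub (2 * Real.pi * (n : ℝ)) (-θ)
    rwa [abs_neg, sub_neg_eq_add, add_comm (2 * Real.pi * (n : ℝ))] at this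
  rw [lengthCoeff, norm_div, Complex.norm_exp, Complex.norm_real, Real.norm_eq_abs, abs_abs,
    div_mul_eq_mul_div]
  have h4 : (-((|θ + 2 * Real.pi * n| : ℝ) : ℂ) * σ).re = -|θ + 2 * Real.pi * n| * σ.re := by
    simp
  rw [h4, ← Real.exp_nat_mul, ← Real.exp_add]
  refine div_le_div₀ (Real.exp_pos _).le (Real.exp_le_exp.mpr ?_) hs h1
  nlinarith

section

variable {g k : SO3} {θ : ℝ}

theorem IsSphereGeodesicFlow.mem_lengthSpectrum_iff (hφ : IsSphereGeodesicFlow φ)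
    (hg : g = k * rotZ θ * k⁻¹) (hθ : Real.sin θ ≠ 0) (l : ℝ) :
    l ∈ lengthSpectrum φ g ↔ ∃ n : ℤ, l = θ + 2 * Real.pi * n ∨ l = -θ + 2 * Real.pi * n := by
  constructor
  · rintro ⟨_, m, hm⟩
    obtain ⟨A, rfl⟩ := exists_smul_baseFrame m
    rw [hφ.eq_smul_iff, hg] at hm
    exact angle_of_conj hm.symm
  · rintro ⟨n, rfl | rfl⟩
    · refine ⟨fun h => hθ ?_, k • baseFrame, ?_⟩
      · rw [← sin_add_two_pi_mul_int θ n, h, Real.sin_zero]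
      · rw [hφ.eq_smul_iff, rotZ_add_two_pi_mul_int, hg]
    -- In the flipped frame `g` is the rotation by `-θ`.
    · refine ⟨fun h => hθ ?_, (k * SO3.flip) • baseFrame, ?_⟩
      · rw [← neg_eq_zero, ← Real.sin_neg, ← sin_add_two_pi_mul_int (-θ) n, h, Real.sin_zero]
      · rw [hφ.eq_smul_iff, rotZ_add_two_pi_mul_int, hg, ← flip_mul_rotZ_neg θ]
        group

theorem IsSphereGeodesicFlow.countable_lengthSpectrum (hφ : IsSphereGeodesicFlow φ)
    (hg : g = k * rotZ θ * k⁻¹) (hθ : Real.sin θ ≠ 0) : (lengthSpectrum φ g).Countable := by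
  refine ((Set.countable_range fun n : ℤ => θ + 2 * Real.pi * n).union
    (Set.countable_range fun n : ℤ => -θ + 2 * Real.pi * n)).mono fun l hl => ?_
  obtain ⟨n, rfl | rfl⟩ := (hφ.mem_lengthSpectrum_iff hg hθ l).mp hl
  · exact Or.inl ⟨n, rfl⟩
  · exact Or.inr ⟨n, rfl⟩

theorem IsSphereGeodesicFlow.hasSum_lengthSpectrum (hφ : IsSphereGeodesicFlow φ)
    (hg : g = k * rotZ θ * k⁻¹) (hθ : Real.sin θ ≠ 0) {f : ℝ → ℂ} {a b : ℂ}
    (ha : HasSum (fun n : ℤ => f (θ + 2 * Real.pi * n)) a)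
    (hb : HasSum (fun n : ℤ => f (-θ + 2 * Real.pi * n)) b) :
    HasSum (fun l : lengthSpectrum φ g => f l) (a + b) := by
  let e : ℤ ⊕ ℤ → lengthSpectrum φ g := Sum.elim
    (fun n => ⟨θ + 2 * Real.pi * n, (hφ.mem_lengthSpectrum_iff hg hθ _).mpr ⟨n, Or.inl rfl⟩⟩)
    (fun n => ⟨-θ + 2 * Real.pi * n, (hφ.mem_lengthSpectrum_iff hg hθ _).mpr ⟨n, Or.inr rfl⟩⟩)
  -- The two families have opposite nonzero sines, so the spectrum is a disjoint union of two copies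
  -- of `ℤ`.
  have hne : ∀ i j : ℤ, θ + 2 * Real.pi * i ≠ -θ + 2 * Real.pi * j := by
    intro i j hij
    have h := congrArg Real.sin hij
    rw [sin_add_two_pi_mul_int, sin_add_two_pi_mul_int, Real.sin_neg] at h
    apply hθ
    linarith
  have hcancel : ∀ (t : ℝ) (i j : ℤ), t + 2 * Real.pi * i = t + 2 * Real.pi * j → i = j := by
    intro t i j hij
    have := mul_left_cancel₀ Real.two_pi_pos.ne' (add_left_cancel hij)
    exact_mod_cast this
  have he : Function.Bijective e := by
    constructor
    · rintro (i | i) (j | j) hij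
      · exact congrArg Sum.inl (hcancel _ _ _ (congrArg Subtype.val hij))
      · exact absurd (congrArg Subtype.val hij) (hne i j)
      · exact absurd (congrArg Subtype.val hij).symm (hne j i)
      · exact congrArg Sum.inr (hcancel _ _ _ (congrArg Subtype.val hij))
    · rintro ⟨l, hl⟩
      obtain ⟨n, rfl | rfl⟩ := (hφ.mem_lengthSpectrum_iff hg hθ l).mp hl
      · exact ⟨Sum.inl n, rfl⟩
      · exact ⟨Sum.inr n, rfl⟩
  rw [← (Equiv.ofBijective e he).hasSum_iff]
  exact HasSum.sum ha hb

/-- The conjugate `h * g * h⁻¹` is the rotation by `θ` in the frame `h * k` and by `-θ` in the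
flipped frame; each family contributes its own orbit integral as a common factor. -/
theorem IsSphereGeodesicFlow.hasSum_lengthTerm (hφ : IsSphereGeodesicFlow φ)
    (hg : g = k * rotZ θ * k⁻¹) (hθ : Real.sin θ ≠ 0) (χ : sphereBundle → ℝ) {σ : ℂ}
    (hσ : 0 < σ.re) (h : SO3) :
    HasSum (fun l : lengthSpectrum φ g =>
        lengthTerm φ (trivialLineConnection sphereBundle) χ σ (h * g * h⁻¹) l)
      ((∑' n, lengthCoeff σ θ n) * (flowCurveIntegral χ (h * k) : ℂ) +
        (∑' n, lengthCoeff σ (-θ) n) * (flowCurveIntegral χ (h * (k * SO3.flip)) : ℂ)) := by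
  have hθ' : Real.sin (-θ) ≠ 0 := by rwa [Real.sin_neg, neg_ne_zero]
  have hx : h * g * h⁻¹ = h * k * rotZ θ * (h * k)⁻¹ := by rw [hg]; group
  have hx' : h * g * h⁻¹ = h * (k * SO3.flip) * rotZ (-θ) * (h * (k * SO3.flip))⁻¹ := by
    rw [hg, ← flip_mul_rotZ_neg θ]; group
  apply hφ.hasSum_lengthSpectrum hg hθ
  · simp only [hφ.lengthTerm_eq hx hθ]
    exact (summable_lengthCoeff hσ hθ).hasSum.mul_right _
  · simp only [hφ.lengthTerm_eq hx' hθ']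
    exact (summable_lengthCoeff hσ hθ').hasSum.mul_right _

theorem IsSphereGeodesicFlow.summable_orbitWeight (hφ : IsSphereGeodesicFlow φ)
    (hg : g = k * rotZ θ * k⁻¹) (hθ : Real.sin θ ≠ 0) (χ : sphereBundle → ℝ) (h : SO3)
    (l : lengthSpectrum φ g) :
    Summable (orbitWeight φ (trivialLineConnection sphereBundle) χ (h * g * h⁻¹) l) := by
  obtain ⟨l, hl⟩ := l
  have hl' := (hφ.mem_lengthSpectrum_iff hg hθ l).mp hl
  obtain ⟨_, m, hm⟩ := hl
  obtain ⟨A, rfl⟩ := exists_smul_baseFrame m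
  rw [hφ.eq_smul_iff] at hm
  have hx : h * g * h⁻¹ = h * A * rotZ l * (h * A)⁻¹ :=
    (congrArg (fun y => h * y * h⁻¹) hm).trans (by group)
  refine (hφ.hasSum_orbitWeight hx ?_ χ).summable
  obtain ⟨n, rfl | rfl⟩ := hl'
  · rwa [sin_add_two_pi_mul_int]
  · rwa [sin_add_two_pi_mul_int, Real.sin_neg, neg_ne_zero]

end

/-! ## Cutoff functions -/

theorem IsSmoothOnEmb.continuous {E : Type*} [NormedAddCommGroup E] [NormedSpace ℝ E] {M : Set E}
    {χ : M → ℝ} (hχ : IsSmoothOnEmb M χ) : Continuous χ := by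
  rw [continuous_iff_continuousAt]
  intro m
  obtain ⟨f, hf, hfχ⟩ := hχ m
  exact ((hf.continuous.comp continuous_subtype_val).continuousAt).congr hfχ

/-- Compactness of the bundle and total mass one make the constant function admissible. -/
theorem isCutoffFunction_one [MeasurableSpace SO3] (μ : Measure SO3) [IsProbabilityMeasure μ] :
    IsCutoffFunction μ (fun _ : sphereBundle => (1 : ℝ)) where
  smooth _ := ⟨fun _ => 1, contDiff_const, Filter.Eventually.of_forall fun _ => rfl⟩
  compact_support := HasCompactSupport.of_compactSpace _
  integrable_orbit _ := integrable_const 1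
  integral_orbit _ := by simp

theorem continuous_rotZ : Continuous rotZ := by
  refine Continuous.subtype_mk (continuous_matrix fun i j => ?_) _
  fin_cases i <;> fin_cases j <;> simp <;> fun_prop

section

variable {χ : sphereBundle → ℝ}

theorem continuous_apply_smul_rotZ (hχ : Continuous χ) :
    Continuous fun q : SO3 × ℝ => χ ((q.1 * rotZ q.2) • baseFrame) := by
  have h1 : Continuous fun q : SO3 × ℝ => q.1 * rotZ q.2 :=
    Continuous.mul continuous_fst (continuous_rotZ.comp continuous_snd)
  exact hχ.comp (h1.smul continuous_const)

theorem continuous_flowCurveIntegral (hχ : Continuous χ) : Continuous (flowCurveIntegral χ) :=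
  intervalIntegral.continuous_parametric_intervalIntegral_of_continuous'
    (f := fun A s => χ ((A * rotZ s) • baseFrame)) (continuous_apply_smul_rotZ hχ) _ _

theorem exists_bound_flowCurveIntegral (hχ : Continuous χ) :
    ∃ C, ∀ A, |flowCurveIntegral χ A| ≤ C := by
  obtain ⟨C, hC⟩ := isCompact_univ.exists_bound_of_continuousOn hχ.continuousOn
  refine ⟨C * |2 * Real.pi - 0|, fun A => ?_⟩
  exact intervalIntegral.norm_integral_le_of_norm_le_const fun s _ => hC _ (Set.mem_univ _)

variable [MeasurableSpace SO3] [BorelSpace SO3] {μ : Measure SO3}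

/-- By Fubini: at each time `s` the average of `χ` over the group is `1`, and `s` runs over an
interval of length `2π`. -/
theorem IsCutoffFunction.integral_flowCurveIntegral [IsProbabilityMeasure μ]
    (hχ : IsCutoffFunction μ χ) (A : SO3) :
    ∫ x, flowCurveIntegral χ (x * A) ∂μ = 2 * Real.pi := by
  have hc := hχ.smooth.continuous
  obtain ⟨C, hC⟩ := isCompact_univ.exists_bound_of_continuousOn hc.continuousOn
  simp only [flowCurveIntegral, intervalIntegral.integral_of_le Real.two_pi_pos.le]
  rw [integral_integral_swap]
  · have h : ∀ s : ℝ, ∫ x, χ ((x * A * rotZ s) • baseFrame) ∂μ = 1 := by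
      intro s
      have := hχ.integral_orbit ((A * rotZ s) • baseFrame)
      simpa only [smul_smul, mul_assoc] using this
    simp only [h]
    simp [Real.pi_pos.le]
  · have h1 : Continuous fun q : SO3 × ℝ => (q.1 * A, q.2) :=
      (Continuous.mul continuous_fst continuous_const).prodMk continuous_snd
    have h2 := (continuous_apply_smul_rotZ hc).comp h1
    exact Integrable.of_bound h2.aestronglyMeasurable C
      (Filter.Eventually.of_forall fun q => hC _ (Set.mem_univ _))

end

/-! ## Integration over the homogeneous space -/

section

variable [MeasurableSpace SO3] [BorelSpace SO3] (Z : Subgroup SO3)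

instance : OpensMeasurableSpace (SO3 ⧸ Z) where
  borel_le := by
    refine MeasurableSpace.generateFrom_le fun U hU => ?_
    exact measurableSet_quotient.mpr
      (QuotientGroup.continuous_mk.isOpen_preimage U hU).measurableSet

instance : MeasurableConstSMul SO3 (SO3 ⧸ Z) where
  measurable_const_smul c := by
    refine measurable_from_quotient.mpr ?_
    exact (measurable_quotient_mk'' (s := QuotientGroup.leftRel Z)).comp
      ((continuous_const_mul c).measurable)

variable {Z}

/-- The integral over `G/Z` of a bounded continuous function is computed by first averaging
over `G`. -/
theorem integral_quotient_eq_of_average {μ : Measure SO3} [IsProbabilityMeasure μ]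
    {ν : Measure (SO3 ⧸ Z)} [IsProbabilityMeasure ν] [SMulInvariantMeasure SO3 (SO3 ⧸ Z) ν]
    {F : SO3 ⧸ Z → ℝ} (hF : Continuous F) {C : ℝ} (hC : ∀ q, |F q| ≤ C) {a : ℝ}
    (ha : ∀ q, ∫ x, F (x • q) ∂μ = a) : ∫ q, F q ∂ν = a := by
  -- Insert an average over `G`, translate by invariance of `ν`, and swap the integrals.
  calc ∫ q, F q ∂ν = ∫ _x : SO3, ∫ q, F q ∂ν ∂μ := by simp
    _ = ∫ x : SO3, ∫ q, F (x • q) ∂ν ∂μ := by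
      congr 1
      ext x
      exact (integral_smul_eq_self F).symm
    _ = ∫ q, ∫ x : SO3, F (x • q) ∂μ ∂ν := by
      refine integral_integral_swap (Integrable.of_bound (C := C) ?_ ?_)
      · exact (hF.comp continuous_smul).aestronglyMeasurable
      · exact Filter.Eventually.of_forall fun q => hC _
    _ = a := by simp [ha]

end

section

variable {g A : SO3} {l : ℝ}

/-- Conjugated by `A`, the centraliser consists of rotations about the third axis, that is, of time
shifts. Hence the orbit integral descends to `G/Z`. -/
theorem flowCurveIntegral_mul_centralizer (hg : g = A * rotZ l * A⁻¹) (hl : Real.sin l ≠ 0)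
    (χ : sphereBundle → ℝ) (h : SO3) (z : Subgroup.centralizer {g}) :
    flowCurveIntegral χ (h * z * A) = flowCurveIntegral χ (h * A) := by
  have hz : g * (z : SO3) = z * g := Subgroup.mem_centralizer_iff.mp z.2 g rfl
  obtain ⟨s, hs⟩ := exists_rotZ_of_commute (K := A⁻¹ * z * A) hl (by
    have h2 : rotZ l = A⁻¹ * g * A := by rw [hg]; group
    calc A⁻¹ * z * A * rotZ l = A⁻¹ * (z * g) * A := by rw [h2]; group
      _ = rotZ l * (A⁻¹ * z * A) := by rw [← hz, h2]; group)
  have h3 : h * z * A = h * A * rotZ s := by rw [← hs]; group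
  rw [h3, flowCurveIntegral_mul_rotZ]

theorem integrable_and_integral_flowCurveIntegral [MeasurableSpace SO3] [BorelSpace SO3]
    {μ : Measure SO3} [IsProbabilityMeasure μ] {χ : sphereBundle → ℝ} (hχ : IsCutoffFunction μ χ)
    (hg : g = A * rotZ l * A⁻¹) (hl : Real.sin l ≠ 0)
    (ν : Measure (SO3 ⧸ Subgroup.centralizer {g})) [IsProbabilityMeasure ν]
    [SMulInvariantMeasure SO3 (SO3 ⧸ Subgroup.centralizer {g}) ν] :
    Integrable (fun q => flowCurveIntegral χ (q.out * A)) ν ∧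
      ∫ q, flowCurveIntegral χ (q.out * A) ∂ν = 2 * Real.pi := by
  have hc := hχ.smooth.continuous
  have hmk : ∀ h : SO3,
      flowCurveIntegral χ ((QuotientGroup.mk h : SO3 ⧸ Subgroup.centralizer {g}).out * A) =
        flowCurveIntegral χ (h * A) := by
    intro h
    obtain ⟨z, hz⟩ := QuotientGroup.mk_out_eq_mul (Subgroup.centralizer {g}) h
    rw [hz, flowCurveIntegral_mul_centralizer hg hl]
  -- The representative `q.out` need not depend continuously on `q`, but the integral does not
  -- depend on it, so continuity descends from `G`.
  have hF : Continuous fun q : SO3 ⧸ Subgroup.centralizer {g} =>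
      flowCurveIntegral χ (q.out * A) := by
    rw [(QuotientGroup.isQuotientMap_mk (Subgroup.centralizer {g})).continuous_iff]
    refine ((continuous_flowCurveIntegral hc).comp (continuous_mul_const A)).congr fun h => ?_
    exact (hmk h).symm
  obtain ⟨C, hC⟩ := exists_bound_flowCurveIntegral hc
  refine ⟨Integrable.of_bound hF.aestronglyMeasurable C (Filter.Eventually.of_forall fun q => hC _),
    integral_quotient_eq_of_average hF (fun q => hC _) (μ := μ) fun q => ?_⟩
  induction q using QuotientGroup.induction_on with | H h =>
  rw [← hχ.integral_flowCurveIntegral (h * A)]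
  congr 1
  ext x
  rw [← mul_assoc, ← hmk (x * h)]
  rfl

end

/-! ## The equivariant Ruelle zeta function of the geodesic flow -/

section

variable {g k : SO3} {θ : ℝ}

theorem IsSphereGeodesicFlow.ruelleIntegrand_eq (hφ : IsSphereGeodesicFlow φ)
    (hg : g = k * rotZ θ * k⁻¹) (hθ : Real.sin θ ≠ 0) (χ : sphereBundle → ℝ) {σ : ℂ}
    (hσ : 0 < σ.re) :
    ruelleIntegrand φ (trivialLineConnection sphereBundle) χ g σ = fun q =>
      (∑' n, lengthCoeff σ θ n) * (flowCurveIntegral χ (q.out * k) : ℂ) +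
        (∑' n, lengthCoeff σ (-θ) n) * (flowCurveIntegral χ (q.out * (k * SO3.flip)) : ℂ) := by
  ext q
  conv_lhs => rw [← QuotientGroup.out_eq' q]
  exact (hφ.hasSum_lengthTerm hg hθ χ hσ q.out).tsum_eq

/-- Both presentations of `g`, by `θ` in the frame `k` and by `-θ` in the flipped frame, give an
integral `2π` over `G/Z`; half of it is the factor `π`. -/
theorem IsSphereGeodesicFlow.ruelleConvergesAt_and_logRuelle_eq [MeasurableSpace SO3]
    [BorelSpace SO3] (hφ : IsSphereGeodesicFlow φ)
    (hg : g = k * rotZ θ * k⁻¹) (hθ : Real.sin θ ≠ 0) {μ : Measure SO3} [IsProbabilityMeasure μ]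
    (ν : Measure (SO3 ⧸ Subgroup.centralizer {g})) [IsProbabilityMeasure ν]
    [SMulInvariantMeasure SO3 (SO3 ⧸ Subgroup.centralizer {g}) ν] {χ : sphereBundle → ℝ}
    (hχ : IsCutoffFunction μ χ) {σ : ℂ} (hσ : 0 < σ.re) :
    RuelleConvergesAt φ (trivialLineConnection sphereBundle) χ g ν σ ∧
      logRuelle φ (trivialLineConnection sphereBundle) χ g ν σ =
        (Real.pi : ℂ) * ∑' n, (lengthCoeff σ θ n + lengthCoeff σ (-θ) n) := by
  have hθ' : Real.sin (-θ) ≠ 0 := by rwa [Real.sin_neg, neg_ne_zero]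
  have hg' : g = k * SO3.flip * rotZ (-θ) * (k * SO3.flip)⁻¹ := by
    rw [hg, ← flip_mul_rotZ_neg θ]; group
  obtain ⟨i1, e1⟩ := integrable_and_integral_flowCurveIntegral hχ hg hθ ν
  obtain ⟨i2, e2⟩ := integrable_and_integral_flowCurveIntegral hχ hg' hθ' ν
  have j1 : Integrable (fun q => (∑' n, lengthCoeff σ θ n) *
      (flowCurveIntegral χ (q.out * k) : ℂ)) ν := i1.ofReal.const_mul _
  have j2 : Integrable (fun q => (∑' n, lengthCoeff σ (-θ) n) *
      (flowCurveIntegral χ (q.out * (k * SO3.flip)) : ℂ)) ν := i2.ofReal.const_mul _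
  have hR := hφ.ruelleIntegrand_eq hg hθ χ hσ
  refine ⟨⟨fun q l => ?_, fun q => ?_, ?_⟩, ?_⟩
  · induction q using QuotientGroup.induction_on with | H h =>
    exact hφ.summable_orbitWeight hg hθ χ h l
  · induction q using QuotientGroup.induction_on with | H h =>
    exact (hφ.hasSum_lengthTerm hg hθ χ hσ h).summable
  · rw [hR]
    exact j1.add j2
  · rw [logRuelle, hR]
    beta_reduce
    rw [integral_add j1 j2, integral_const_mul, integral_const_mul, integral_complex_ofReal,
      integral_complex_ofReal, e1, e2, (summable_lengthCoeff hσ hθ).tsum_add (summable_lengthCoeff hσ hθ')]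
    push_cast
    ring

end

/-! ## Density of the powers -/

/-- If `sin θ = 0` then `g² = 1`. The closed condition `x² = 1` would then hold on the whole torus,
but it fails for the quarter turn. -/
theorem sin_ne_zero_of_dense_zpow {g k : SO3} {θ : ℝ} (hg : g = k * rotZ θ * k⁻¹)
    (hdense : ∀ α : ℝ, k * rotZ α * k⁻¹ ∈ closure (Set.range fun n : ℤ => g ^ n)) :
    Real.sin θ ≠ 0 := by
  intro hθ
  obtain ⟨m, hm⟩ := Real.sin_eq_zero_iff.mp hθ
  have hg2 : g * g = 1 := by
    have h1 : rotZ θ * rotZ θ = 1 := by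
      rw [← rotZ_add, rotZ_eq_one_iff]
      exact ⟨m, by rw [← hm]; ring⟩
    calc g * g = k * (rotZ θ * rotZ θ) * k⁻¹ := by rw [hg]; group
      _ = 1 := by rw [h1]; group
  have hclosed : IsClosed {x : SO3 | x * x = 1} :=
    isClosed_eq (continuous_id.mul continuous_id) continuous_const
  have hsub : (Set.range fun n : ℤ => g ^ n) ⊆ {x : SO3 | x * x = 1} := by
    rintro _ ⟨n, rfl⟩
    change g ^ n * g ^ n = 1
    rw [← (Commute.refl g).mul_zpow, hg2, one_zpow]
  have h2 : k * rotZ (Real.pi / 2) * k⁻¹ * (k * rotZ (Real.pi / 2) * k⁻¹) = 1 :=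
    hclosed.closure_subset_iff.mpr hsub (hdense (Real.pi / 2))
  have h3 : rotZ Real.pi = 1 := by
    calc rotZ Real.pi = rotZ (Real.pi / 2) * rotZ (Real.pi / 2) := by rw [← rotZ_add, add_halves]
      _ = k⁻¹ * (k * rotZ (Real.pi / 2) * k⁻¹ * (k * rotZ (Real.pi / 2) * k⁻¹)) * k := by group
      _ = 1 := by rw [h2]; group
  obtain ⟨n, hn⟩ := (rotZ_eq_one_iff _).mp h3
  have := (Real.cos_eq_one_iff _).mpr ⟨n, hn⟩
  rw [Real.cos_pi] at this
  norm_num at this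

/-! ## The identity element -/

section

theorem IsSphereGeodesicFlow.not_isNondegenerateFlow_one (hφ : IsSphereGeodesicFlow φ) :
    ¬ IsNondegenerateFlow φ (1 : SO3) := by
  rw [hφ.isNondegenerateFlow_iff]
  intro h
  refine h (2 * Real.pi) 1 Real.two_pi_pos.ne' ?_ Real.cos_two_pi
  rw [(rotZ_eq_one_iff _).mpr ⟨1, by simp⟩]
  group

/-- The third component of `p × v`. -/
def angularMomentum (m : sphereBundle) : ℝ :=
  m.1.1 0 * m.1.2 1 - m.1.1 1 * m.1.2 0

/-- The flow rotates `p` and `v` within their plane, which multiplies this minor by the determinant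
`cos² t + sin² t`. -/
theorem IsSphereGeodesicFlow.angularMomentum_apply (hφ : IsSphereGeodesicFlow φ) (t : ℝ)
    (m : sphereBundle) : angularMomentum (φ t m) = angularMomentum m := by
  rw [angularMomentum, hφ.coe_apply, angularMomentum]
  simp only [PiLp.add_apply, PiLp.smul_apply, smul_eq_mul]
  linear_combination (m.1.1 0 * m.1.2 1 - m.1.1 1 * m.1.2 0) * Real.cos_sq_add_sin_sq t

theorem exists_angularMomentum_eq (a : ℝ) : ∃ m : sphereBundle, angularMomentum m = Real.sin a := by
  refine ⟨⟨(!₂[1, 0, 0], !₂[0, Real.sin a, Real.cos a]), ?_, ?_, ?_⟩, ?_⟩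
  · simp [EuclideanSpace.norm_eq, Fin.sum_univ_three]
  · simp [EuclideanSpace.norm_eq, Fin.sum_univ_three]
  · simp [PiLp.inner_apply, Fin.sum_univ_three]
  · simp [angularMomentum]

theorem IsSphereGeodesicFlow.uncountable_periodicOrbits_one (hφ : IsSphereGeodesicFlow φ) (j : ℤ) :
    Uncountable (PeriodicOrbits φ (1 : SO3) (2 * Real.pi * j)) := by
  let f : PeriodicOrbits φ (1 : SO3) (2 * Real.pi * j) → ℝ :=
    Quotient.lift (fun γ => angularMomentum (γ.1 0)) (by
      rintro γ γ' ⟨s, hs⟩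
      rw [hs, zero_add, γ.2.1 s, hφ.angularMomentum_apply])
  -- Every point is periodic with period `2πj`, so a great circle of any inclination gives an orbit;
  -- its angular momentum takes all values in `[-1, 1]`.
  have hf : Set.Icc (-1 : ℝ) 1 ⊆ Set.range f := by
    intro c hc
    obtain ⟨m, hm⟩ := exists_angularMomentum_eq (Real.arcsin c)
    rw [Real.sin_arcsin hc.1 hc.2] at hm
    refine ⟨Quotient.mk _ ⟨fun t => φ t m, fun t => ?_, ?_⟩, ?_⟩
    · simp only [hφ.map_zero]
    · obtain ⟨A, rfl⟩ := exists_smul_baseFrame m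
      simp only [hφ.map_zero, one_smul]
      rw [hφ.smul_baseFrame, (rotZ_eq_one_iff _).mpr ⟨j, by ring⟩, mul_one]
    · change angularMomentum (φ 0 m) = c
      rw [hφ.map_zero, hm]
  rw [← not_countable_iff]
  intro hcount
  have h1 : (Set.Icc (-1 : ℝ) 1).Countable := (Set.countable_range f).mono hf
  exact absurd h1 (by
    rw [← Cardinal.le_aleph0_iff_set_countable, Cardinal.mk_Icc_real (by norm_num), not_le]
    exact Cardinal.aleph0_lt_continuum)

end

end

theorem proposition6p7
    [MeasurableSpace SO3] [BorelSpace SO3]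
    (φ : ℝ → sphereBundle → sphereBundle) (hφ : IsSphereGeodesicFlow φ)
    (g k : SO3) (θ : ℝ) (hg : g = k * rotZ θ * k⁻¹)
    (hdense : ∀ α : ℝ, k * rotZ α * k⁻¹ ∈ closure (Set.range fun n : ℤ => g ^ n))
    (μ : MeasureTheory.Measure SO3) [μ.IsHaarMeasure] [MeasureTheory.IsProbabilityMeasure μ]
    (ν : MeasureTheory.Measure (SO3 ⧸ Subgroup.centralizer {g}))
    [MeasureTheory.IsProbabilityMeasure ν]
    [MeasureTheory.SMulInvariantMeasure SO3 (SO3 ⧸ Subgroup.centralizer {g}) ν] :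
    IsNondegenerateFlow φ g ∧
    (lengthSpectrum φ g).Countable ∧
    (∃ χ : sphereBundle → ℝ, IsCutoffFunction μ χ) ∧
    (∀ χ : sphereBundle → ℝ, IsCutoffFunction μ χ → ∀ σ : ℂ, 0 < σ.re →
      RuelleConvergesAt φ (trivialLineConnection sphereBundle) χ g ν σ ∧
      Summable (fun n : ℤ =>
        Complex.exp (-((|θ + 2 * Real.pi * n| : ℝ) : ℂ) * σ)
            / ((|θ + 2 * Real.pi * n| : ℝ) : ℂ)
          + Complex.exp (-((|-θ + 2 * Real.pi * n| : ℝ) : ℂ) * σ)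
            / ((|-θ + 2 * Real.pi * n| : ℝ) : ℂ)) ∧
      logRuelle φ (trivialLineConnection sphereBundle) χ g ν σ =
        (Real.pi : ℂ) * ∑' n : ℤ,
          (Complex.exp (-((|θ + 2 * Real.pi * n| : ℝ) : ℂ) * σ)
              / ((|θ + 2 * Real.pi * n| : ℝ) : ℂ)
            + Complex.exp (-((|-θ + 2 * Real.pi * n| : ℝ) : ℂ) * σ)
              / ((|-θ + 2 * Real.pi * n| : ℝ) : ℂ))) ∧
    (¬ IsNondegenerateFlow φ (1 : SO3) ∧
      ∀ j : ℤ, j ≠ 0 → Uncountable (PeriodicOrbits φ (1 : SO3) (2 * Real.pi * j))) := by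
  have hθ := sin_ne_zero_of_dense_zpow hg hdense
  have hθ' : Real.sin (-θ) ≠ 0 := by rwa [Real.sin_neg, neg_ne_zero]
  refine ⟨?_, hφ.countable_lengthSpectrum hg hθ, ⟨_, isCutoffFunction_one μ⟩, ?_,
    hφ.not_isNondegenerateFlow_one, fun j _ => hφ.uncountable_periodicOrbits_one j⟩
  · rw [hφ.isNondegenerateFlow_iff]
    intro l A _ hl hc
    -- Degeneracy would force `sin l = 0`, whereas a return time `±θ + 2πn` has `sin l = ±sin θ`.
    have hs : Real.sin l = 0 := by
      have := Real.sin_sq_add_cos_sq l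
      rw [hc] at this
      nlinarith
    rw [hg] at hl
    obtain ⟨n, rfl | rfl⟩ := angle_of_conj hl.symm
    · exact hθ (by rwa [sin_add_two_pi_mul_int] at hs)
    · exact hθ' (by rwa [sin_add_two_pi_mul_int] at hs)
  · intro χ hχ σ hσ
    obtain ⟨h1, h2⟩ := hφ.ruelleConvergesAt_and_logRuelle_eq hg hθ ν hχ hσ
    exact ⟨h1, (summable_lengthCoeff hσ hθ).add (summable_lengthCoeff hσ hθ'), h2⟩
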